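/- Let $K$ be a number field that is a normal extension of $\mathbb{Q}$ of degree $N=[K:\mathbb{Q}]\ge 2$, with ring of integers $\mathcal{O}_K$. For $n\in\mathbb{Z}$ put $\mathbf{b}_K(n)=1$ if there is a nonzero integral ideal of $\mathcal{O}_K$ of norm $n$, and $\mathbf{b}_K(n)=0$ otherwise (so $\mathbf{b}_K(n)=0$ for $n\le 0$). For a divisor $r$ of $N$, let $\mathbb{P}_r$ be the set of rational primes $p$ such that $(p)=\mathfrak{P}_1\cdots\mathfrak{P}_{N/r}$ with distinct prime ideals $\mathfrak{P}_i$ of $\mathcal{O}_K$ of norm $p^r$ each. **Theorem.** Let $M\ge 2$. There exist real constants $C>0$ and $x_0$, depending only on $M$ and $K$, such that the following holds. Let $(a_m,b_m)\in\mathbb{Z}^+\times\mathbb{Z}$ for $m=1,\dots,M$ be such that $$\prod_{\substack{m,k=1\\ m\ne k}}^M (a_m b_k-a_k b_m)\ne 0 .$$ Then for every real $x\ge x_0$, $$\sum_{1\le n\le x}\ \prod_{m=1}^M \mathbf{b}_K(a_m n+b_m)\ \le\ C\,\gamma\,\frac{x}{(\log x)^{M(1-1/N)}},\qquad \gamma=\prod_{p\in\mathbb{P}'}\Bigl(1+\frac{M}{p}\Bigr),$$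 where $\mathbb{P}'$ is the finite set of all primes $p\in\bigcup_{r\mid N,\ r>1}\mathbb{P}_r$ (that is, unramified primes that do not split completely in $K$) which divide $\prod_{m=1}^M a_m\,\prod_{m,k=1,\ m\ne k}^M (a_m b_k-a_k b_m)$. -/

import Mathlib

open NumberField

namespace BNumbers

noncomputable section

open Classical in
/-- The indicator `b_K(n)`: it is `1` if `n` is the norm of some (nonzero) integral ideal of `𝓞 K`,
and `0` otherwise; in particular it vanishes for `n ≤ 0`. -/
def idealNormIndicator (K : Type*) [Field K] [NumberField K] (n : ℤ) : ℕ :=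
  if ∃ I : Ideal (𝓞 K), I ≠ ⊥ ∧ (Ideal.absNorm I : ℤ) = n then 1 else 0

/-- The sum `S(a₁,b₁,…,a_M,b_M; x)`, over positive integers `n ≤ x`, of `∏ₘ b_K(aₘ n + bₘ)`. -/
def tupleSum (K : Type*) [Field K] [NumberField K] {M : ℕ} (a b : Fin M → ℤ) (x : ℝ) : ℕ :=
  ∑ n ∈ Finset.Icc 1 ⌊x⌋₊, ∏ m, idealNormIndicator K (a m * (n : ℤ) + b m)

/-- The product of `aₘ bₖ - aₖ bₘ` over all ordered pairs of indices `m ≠ k`. -/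
def crossProduct {M : ℕ} (a b : Fin M → ℤ) : ℤ :=
  ∏ m, ∏ k ∈ Finset.univ.filter (fun k => k ≠ m), (a m * b k - a k * b m)

/-- The rational primes `p` such that `(p)` is a product of `N / r` distinct prime ideals of norm
`p ^ r` each, where `r` divides the degree `N = [K : ℚ]`. -/
def primesOfDegree (K : Type*) [Field K] [NumberField K] (r : ℕ) : Set ℕ :=
  {p | p.Prime ∧ r ∣ Module.finrank ℚ K ∧ ∃ s : Finset (Ideal (𝓞 K)),
    s.card = Module.finrank ℚ K / r ∧
    (∀ P ∈ s, P.IsPrime ∧ Ideal.absNorm P = p ^ r) ∧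
    Ideal.span {(p : 𝓞 K)} = ∏ P ∈ s, P}

/-- The unramified rational primes that do not split completely: the union of the classes
`primesOfDegree K r` over `r > 1`. -/
def nonsplitPrimes (K : Type*) [Field K] [NumberField K] : Set ℕ :=
  {p | ∃ r : ℕ, 1 < r ∧ p ∈ primesOfDegree K r}

open Classical in
/-- The finite set of primes in `nonsplitPrimes K` dividing `∏ₘ aₘ · ∏_{m ≠ k} (aₘ bₖ - aₖ bₘ)`
(an integer which is assumed nonzero wherever this set is used). -/
def exceptionalPrimes (K : Type*) [Field K] [NumberField K] {M : ℕ} (a b : Fin M → ℤ) :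
    Finset ℕ :=
  ((∏ m, a m) * crossProduct a b).natAbs.primeFactors.filter (fun p => p ∈ nonsplitPrimes K)

theorem mem_exceptionalPrimes (K : Type*) [Field K] [NumberField K] {M : ℕ} (a b : Fin M → ℤ)
    (h : (∏ m, a m) * crossProduct a b ≠ 0) (p : ℕ) :
    p ∈ exceptionalPrimes K a b ↔
      p ∈ nonsplitPrimes K ∧ (p : ℤ) ∣ (∏ m, a m) * crossProduct a b := by
  unfold exceptionalPrimes
  classical
  simp only [Finset.mem_filter, Nat.mem_primeFactors, Int.natCast_dvd]
  constructor
  · rintro ⟨⟨_, h2, _⟩, h4⟩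
    exact ⟨h4, h2⟩
  · rintro ⟨h1, h2⟩
    obtain ⟨r, _, hr⟩ := id h1
    exact ⟨⟨hr.1, h2, Int.natAbs_ne_zero.mpr h⟩, h1⟩

/-- The factor `γ(a₁,b₁,…,a_M,b_M) = ∏_{p} (1 + M / p)` over the exceptional primes `p`. -/
def gammaFactor (K : Type*) [Field K] [NumberField K] {M : ℕ} (a b : Fin M → ℤ) : ℝ :=
  ∏ p ∈ exceptionalPrimes K a b, (1 + (M : ℝ) / (p : ℝ))

end

end BNumbers

namespace SelbergSieve

open Finset

/-- The alternating sum over a Boolean interval of finite sets vanishes unless it is a point. -/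
theorem sum_neg_one_pow_card_between {ι : Type*} [DecidableEq ι] (T S : Finset ι) (hTS : T ⊆ S) :
    ∑ A ∈ S.powerset with T ⊆ A, (-1 : ℝ) ^ #A = if T = S then (-1 : ℝ) ^ #T else 0 := by
  have h1 : ∑ A ∈ S.powerset with T ⊆ A, (-1 : ℝ) ^ #A
      = ∑ B ∈ (S \ T).powerset, (-1 : ℝ) ^ #T * (-1 : ℝ) ^ #B := by
    symm
    refine Finset.sum_bij' (fun B _ => T ∪ B) (fun A _ => A \ T) ?_ ?_ ?_ ?_ ?_
    · intro B hB
      rw [mem_powerset] at hB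
      simp only [mem_filter, mem_powerset]
      exact ⟨union_subset hTS (hB.trans sdiff_subset), subset_union_left⟩
    · intro A hA
      simp only [mem_filter, mem_powerset] at hA ⊢
      exact sdiff_subset_sdiff hA.1 le_rfl
    · intro B hB
      rw [mem_powerset] at hB
      rw [union_sdiff_left, Finset.sdiff_eq_self_iff_disjoint]
      exact disjoint_of_subset_left hB sdiff_disjoint
    · intro A hA
      simp only [mem_filter, mem_powerset] at hA
      exact union_sdiff_of_subset hA.2
    · intro B hB
      rw [mem_powerset] at hB
      rw [card_union_of_disjoint (disjoint_of_subset_right hB disjoint_sdiff), pow_add]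
  rw [h1, ← mul_sum]
  have h2 : ∑ B ∈ (S \ T).powerset, (-1 : ℝ) ^ #B = if S \ T = ∅ then 1 else 0 := by
    exact_mod_cast congrArg (fun z : ℤ => (z : ℝ)) (sum_powerset_neg_one_pow_card (x := S \ T))
  rw [h2]
  have h3 : S \ T = ∅ ↔ T = S := by
    rw [sdiff_eq_empty_iff_subset]
    exact ⟨fun h => hTS.antisymm h, fun h => h.ge⟩
  simp only [h3, mul_ite, mul_one, mul_zero]

section

variable {ι : Type*} [DecidableEq ι] (g : ι → ℝ) (𝒟 : Finset (Finset ι))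

/-- The function `g / (1 - g)` attached to a density `g`. -/
noncomputable def dual (i : ι) : ℝ := g i / (1 - g i)

/-- The sum of `∏ i ∈ A, g i / (1 - g i)` over the members `A` of the support `𝒟`. -/
noncomputable def mass : ℝ := ∑ A ∈ 𝒟, ∏ i ∈ A, dual g i

/-- Selberg's weights, supported on `𝒟`. -/
noncomputable def weight (A : Finset ι) : ℝ :=
  (-1) ^ #A * (∏ i ∈ A, g i)⁻¹ * ((∑ T ∈ 𝒟 with A ⊆ T, ∏ i ∈ T, dual g i) / mass g 𝒟)

variable {g 𝒟} (hg : ∀ A ∈ 𝒟, ∀ i ∈ A, 0 < g i ∧ g i ≤ 1 / 2)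
include hg

omit [DecidableEq ι] in
theorem dual_pos {A : Finset ι} (hA : A ∈ 𝒟) {i : ι} (hi : i ∈ A) : 0 < dual g i :=
  div_pos (hg A hA i hi).1 (by linarith [(hg A hA i hi).2])

omit [DecidableEq ι] in
theorem prod_dual_pos {A : Finset ι} (hA : A ∈ 𝒟) : 0 < ∏ i ∈ A, dual g i :=
  prod_pos fun _ hi => dual_pos hg hA hi

omit [DecidableEq ι] in
theorem prod_density_pos {A : Finset ι} (hA : A ∈ 𝒟) : 0 < ∏ i ∈ A, g i :=
  prod_pos fun i hi => (hg A hA i hi).1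

omit [DecidableEq ι] in
theorem mass_pos (h0 : ∅ ∈ 𝒟) : 0 < mass g 𝒟 :=
  sum_pos (fun _ hA => prod_dual_pos hg hA) ⟨∅, h0⟩

theorem weight_empty (h0 : ∅ ∈ 𝒟) : weight g 𝒟 ∅ = 1 := by
  have := (mass_pos hg h0).ne'
  simp only [weight, card_empty, pow_zero, prod_empty, inv_one, empty_subset, filter_true, mul_one]
  exact (one_mul _).trans (div_self this)

theorem abs_weight_le (h0 : ∅ ∈ 𝒟) (hD : ∀ A ∈ 𝒟, ∀ B ⊆ A, B ∈ 𝒟) {A : Finset ι} (hA : A ∈ 𝒟) :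
    |weight g 𝒟 A| ≤ 2 ^ #A := by
  have hm := mass_pos hg h0
  have hgA := prod_density_pos hg hA
  have key : ∑ T ∈ 𝒟 with A ⊆ T, ∏ i ∈ T, dual g i ≤ (∏ i ∈ A, dual g i) * mass g 𝒟 := by
    have h1 : ∑ T ∈ 𝒟 with A ⊆ T, ∏ i ∈ T, dual g i
        = (∏ i ∈ A, dual g i) * ∑ T ∈ 𝒟 with A ⊆ T, ∏ i ∈ T \ A, dual g i := by
      rw [mul_sum]
      refine sum_congr rfl fun T hT => ?_
      rw [mul_comm, prod_sdiff (mem_filter.1 hT).2]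
    rw [h1]
    refine mul_le_mul_of_nonneg_left ?_ (prod_dual_pos hg hA).le
    have h2 : ∑ T ∈ 𝒟 with A ⊆ T, ∏ i ∈ T \ A, dual g i
        = ∑ U ∈ (𝒟.filter (A ⊆ ·)).image (· \ A), ∏ i ∈ U, dual g i := by
      rw [sum_image]
      intro S hS T hT h
      have hS' := (mem_filter.1 (mem_coe.1 hS)).2
      have hT' := (mem_filter.1 (mem_coe.1 hT)).2
      rw [← union_sdiff_of_subset hS', ← union_sdiff_of_subset hT']
      exact congrArg (A ∪ ·) h
    rw [h2]
    refine sum_le_sum_of_subset_of_nonneg ?_ fun B hB _ => (prod_dual_pos hg hB).le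
    intro U hU
    obtain ⟨T, hT, rfl⟩ := mem_image.1 hU
    exact hD T (mem_filter.1 hT).1 _ sdiff_subset
  have hnn : 0 ≤ ∑ T ∈ 𝒟 with A ⊆ T, ∏ i ∈ T, dual g i :=
    sum_nonneg fun T hT => (prod_dual_pos hg (mem_filter.1 hT).1).le
  have h3 : |weight g 𝒟 A|
      = (∏ i ∈ A, g i)⁻¹ * ((∑ T ∈ 𝒟 with A ⊆ T, ∏ i ∈ T, dual g i) / mass g 𝒟) := by
    rw [weight, abs_mul, abs_mul, abs_pow, abs_neg, abs_one, one_pow, one_mul,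
      abs_of_pos (inv_pos.2 hgA), abs_of_nonneg (div_nonneg hnn hm.le)]
  rw [h3]
  calc _ ≤ (∏ i ∈ A, g i)⁻¹ * (∏ i ∈ A, dual g i) := by
        refine mul_le_mul_of_nonneg_left ?_ (inv_pos.2 hgA).le
        rwa [div_le_iff₀ hm]
    _ = ∏ i ∈ A, (g i)⁻¹ * dual g i := by rw [prod_mul_distrib, prod_inv_distrib]
    _ ≤ ∏ i ∈ A, (2 : ℝ) := by
        refine prod_le_prod (fun i hi => ?_) fun i hi => ?_
        · exact mul_nonneg (inv_pos.2 (hg A hA i hi).1).le (dual_pos hg hA hi).le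
        · have := hg A hA i hi
          rw [dual, div_eq_mul_inv, ← mul_assoc, inv_mul_cancel₀ this.1.ne', one_mul]
          exact inv_le_of_inv_le₀ (by norm_num) (by linarith)
    _ = 2 ^ #A := by rw [prod_const]

theorem sum_weight_mul_prod (hD : ∀ A ∈ 𝒟, ∀ B ⊆ A, B ∈ 𝒟) {T : Finset ι}
    (hT : T ∈ 𝒟) :
    ∑ A ∈ 𝒟 with T ⊆ A, weight g 𝒟 A * ∏ i ∈ A, g i
      = (-1) ^ #T * (∏ i ∈ T, dual g i) / mass g 𝒟 := by
  have h1 : ∀ A ∈ 𝒟.filter (T ⊆ ·), weight g 𝒟 A * ∏ i ∈ A, g i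
      = ∑ S ∈ 𝒟, if A ⊆ S then (-1) ^ #A * (∏ i ∈ S, dual g i) / mass g 𝒟 else 0 := by
    intro A hA
    have := (prod_density_pos hg (mem_filter.1 hA).1).ne'
    rw [← sum_filter, ← sum_div, ← mul_sum, weight]
    field_simp
  rw [sum_congr rfl h1, sum_comm]
  have h2 : ∀ S ∈ 𝒟, (∑ A ∈ 𝒟 with T ⊆ A,
      if A ⊆ S then (-1) ^ #A * (∏ i ∈ S, dual g i) / mass g 𝒟 else 0)
      = if T = S then (-1) ^ #T * (∏ i ∈ S, dual g i) / mass g 𝒟 else 0 := by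
    intro S hS
    by_cases hTS : T ⊆ S
    · rw [← sum_filter, filter_filter]
      have : 𝒟.filter (fun A => T ⊆ A ∧ A ⊆ S) = S.powerset.filter (T ⊆ ·) := by
        ext A
        simp only [mem_filter, mem_powerset]
        exact ⟨fun h => ⟨h.2.2, h.2.1⟩, fun h => ⟨hD S hS A h.1, h.2, h.1⟩⟩
      rw [this, ← sum_div, ← sum_mul, sum_neg_one_pow_card_between T S hTS]
      split_ifs <;> simp
    · rw [if_neg (fun h => hTS h.le)]
      refine sum_eq_zero fun A hA => if_neg fun h => hTS ((mem_filter.1 hA).2.trans h)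
  rw [sum_congr rfl h2, sum_ite_eq 𝒟 T, if_pos hT]

theorem prod_union_density {A B : Finset ι} (hA : A ∈ 𝒟)
    (hD : ∀ A ∈ 𝒟, ∀ B ⊆ A, B ∈ 𝒟) :
    ∏ i ∈ A ∪ B, g i = ∑ T ∈ 𝒟, if T ⊆ A ∧ T ⊆ B then
      (∏ i ∈ T, dual g i)⁻¹ * ((∏ i ∈ A, g i) * ∏ i ∈ B, g i) else 0 := by
  have h1 : 𝒟.filter (fun T => T ⊆ A ∧ T ⊆ B) = (A ∩ B).powerset := by
    ext T
    simp only [mem_filter, mem_powerset, subset_inter_iff]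
    exact ⟨fun h => h.2, fun h => ⟨hD A hA T h.1, h⟩⟩
  rw [← sum_filter, h1, ← sum_mul, ← prod_union_inter]
  have hAB : A ∩ B ∈ 𝒟 := hD A hA _ inter_subset_left
  have h2 : ∑ T ∈ (A ∩ B).powerset, (∏ i ∈ T, dual g i)⁻¹ = (∏ i ∈ A ∩ B, g i)⁻¹ := by
    rw [← prod_inv_distrib]
    simp_rw [← prod_inv_distrib]
    rw [← prod_one_add]
    refine prod_congr rfl fun i hi => ?_
    have := hg _ hAB i hi
    have h3 : (1 - g i) ≠ 0 := by linarith
    have h4 := this.1.ne'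
    rw [dual]
    field_simp
    ring
  rw [h2]
  have := (prod_density_pos hg hAB).ne'
  field_simp

theorem sum_weight_mul_weight (h0 : ∅ ∈ 𝒟) (hD : ∀ A ∈ 𝒟, ∀ B ⊆ A, B ∈ 𝒟) :
    ∑ A ∈ 𝒟, ∑ B ∈ 𝒟, weight g 𝒟 A * weight g 𝒟 B * ∏ i ∈ A ∪ B, g i = (mass g 𝒟)⁻¹ := by
  have hm := (mass_pos hg h0).ne'
  calc _ = ∑ A ∈ 𝒟, ∑ B ∈ 𝒟, ∑ T ∈ 𝒟, (∏ i ∈ T, dual g i)⁻¹ *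
        ((if T ⊆ A then weight g 𝒟 A * ∏ i ∈ A, g i else 0) *
          (if T ⊆ B then weight g 𝒟 B * ∏ i ∈ B, g i else 0)) := by
        refine sum_congr rfl fun A hA => sum_congr rfl fun B _ => ?_
        rw [prod_union_density hg hA hD, mul_sum]
        refine sum_congr rfl fun T _ => ?_
        by_cases h1 : T ⊆ A <;> by_cases h2 : T ⊆ B <;> simp [h1, h2]
        ring
    _ = ∑ T ∈ 𝒟, (∏ i ∈ T, dual g i)⁻¹ *
        (∑ A ∈ 𝒟 with T ⊆ A, weight g 𝒟 A * ∏ i ∈ A, g i) ^ 2 := by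
        rw [sum_congr rfl fun A _ => sum_comm, sum_comm]
        refine sum_congr rfl fun T _ => ?_
        simp_rw [← mul_sum]
        rw [sq, sum_filter, sum_mul_sum]
        simp_rw [← mul_sum]
    _ = ∑ T ∈ 𝒟, (∏ i ∈ T, dual g i) / mass g 𝒟 ^ 2 := by
        refine sum_congr rfl fun T hT => ?_
        rw [sum_weight_mul_prod hg hD hT]
        have := (prod_dual_pos hg hT).ne'
        rw [div_pow, mul_pow, ← pow_mul, mul_comm _ 2, pow_mul, neg_one_sq, one_pow]
        field_simp
    _ = (mass g 𝒟)⁻¹ := by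
        rw [← sum_div]
        change mass g 𝒟 / _ = _
        field_simp

open Classical in
/-- **Selberg's upper bound sieve** for a finite set `s` sifted by the conditions `E i`, with
support `𝒟`. -/
theorem card_sifted_le {α : Type*} (s : Finset α) (E : ι → α → Prop) (h0 : ∅ ∈ 𝒟)
    (hD : ∀ A ∈ 𝒟, ∀ B ⊆ A, B ∈ 𝒟) (X R : ℝ)
    (hR : ∀ A ∈ 𝒟, ∀ B ∈ 𝒟,
      |(#{n ∈ s | ∀ i ∈ A ∪ B, E i n} : ℝ) - X * ∏ i ∈ A ∪ B, g i| ≤ R) :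
    (#{n ∈ s | ∀ A ∈ 𝒟, ∀ i ∈ A, ¬ E i n} : ℝ) ≤
      X / mass g 𝒟 + R * (∑ A ∈ 𝒟, (2 : ℝ) ^ #A) ^ 2 := by
  have h1 : (#{n ∈ s | ∀ A ∈ 𝒟, ∀ i ∈ A, ¬ E i n} : ℝ) ≤
      ∑ n ∈ s, (∑ A ∈ 𝒟, if ∀ i ∈ A, E i n then weight g 𝒟 A else 0) ^ 2 := by
    rw [card_eq_sum_ones, Nat.cast_sum, sum_filter]
    refine sum_le_sum fun n _ => ?_
    split_ifs with h
    · have : (∑ A ∈ 𝒟, if ∀ i ∈ A, E i n then weight g 𝒟 A else 0) = 1 := by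
        rw [sum_eq_single_of_mem ∅ h0, if_pos (by simp), weight_empty hg h0]
        intro A hA hne
        obtain ⟨i, hi⟩ := nonempty_iff_ne_empty.2 hne
        exact if_neg fun h' => h A hA i hi (h' i hi)
      rw [this]
      norm_num
    · positivity
  have h2 : ∑ n ∈ s, (∑ A ∈ 𝒟, if ∀ i ∈ A, E i n then weight g 𝒟 A else 0) ^ 2
      = ∑ A ∈ 𝒟, ∑ B ∈ 𝒟, weight g 𝒟 A * weight g 𝒟 B *
        (#{n ∈ s | ∀ i ∈ A ∪ B, E i n} : ℝ) := by
    simp_rw [sq, sum_mul_sum]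
    rw [sum_comm]
    refine sum_congr rfl fun A _ => ?_
    rw [sum_comm]
    refine sum_congr rfl fun B _ => ?_
    rw [card_eq_sum_ones, Nat.cast_sum, sum_filter, mul_sum]
    refine sum_congr rfl fun n _ => ?_
    have : (∀ i ∈ A ∪ B, E i n) ↔ (∀ i ∈ A, E i n) ∧ (∀ i ∈ B, E i n) := by
      simp only [mem_union, or_imp, forall_and]
    by_cases hA : ∀ i ∈ A, E i n
    · by_cases hB : ∀ i ∈ B, E i n
      · rw [if_pos hA, if_pos hB, if_pos (this.2 ⟨hA, hB⟩), Nat.cast_one, mul_one]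
      · rw [if_neg hB, if_neg fun h => hB (this.1 h).2, mul_zero, mul_zero]
    · rw [if_neg hA, if_neg fun h => hA (this.1 h).1, zero_mul, mul_zero]
  have h3 : ∑ A ∈ 𝒟, ∑ B ∈ 𝒟, weight g 𝒟 A * weight g 𝒟 B *
        (#{n ∈ s | ∀ i ∈ A ∪ B, E i n} : ℝ) ≤
      ∑ A ∈ 𝒟, ∑ B ∈ 𝒟, (X * (weight g 𝒟 A * weight g 𝒟 B * ∏ i ∈ A ∪ B, g i)
        + R * (2 ^ #A * 2 ^ #B)) := by
    refine sum_le_sum fun A hA => sum_le_sum fun B hB => ?_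
    have e := hR A hA B hB
    have hw : |weight g 𝒟 A * weight g 𝒟 B| ≤ 2 ^ #A * 2 ^ #B := by
      rw [abs_mul]
      exact mul_le_mul (abs_weight_le hg h0 hD hA) (abs_weight_le hg h0 hD hB) (abs_nonneg _)
        (by positivity)
    have h4 : weight g 𝒟 A * weight g 𝒟 B *
        ((#{n ∈ s | ∀ i ∈ A ∪ B, E i n} : ℝ) - X * ∏ i ∈ A ∪ B, g i) ≤ 2 ^ #A * 2 ^ #B * R := by
      refine (le_abs_self _).trans ?_
      rw [abs_mul]
      exact mul_le_mul hw e (abs_nonneg _) (by positivity)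
    linarith
  have h5 : ∑ A ∈ 𝒟, ∑ B ∈ 𝒟, (X * (weight g 𝒟 A * weight g 𝒟 B * ∏ i ∈ A ∪ B, g i)
        + R * ((2 : ℝ) ^ #A * 2 ^ #B)) = X / mass g 𝒟 + R * (∑ A ∈ 𝒟, (2 : ℝ) ^ #A) ^ 2 := by
    simp_rw [sum_add_distrib, ← mul_sum]
    rw [sum_weight_mul_weight hg h0 hD, sq, sum_mul, div_eq_mul_inv]
  linarith

end

end SelbergSieve

namespace PeriodicCount

open Finset Function

/-- The number of integers in `[1, X]` satisfying a `q`-periodic condition is `X * c / q` up to an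
error `q`, where `c` is the number of solutions in a period. -/
theorem abs_card_sub_le (P : ℕ → Prop) [DecidablePred P] {q : ℕ} (hq : 0 < q) (hP : Periodic P q) (X : ℕ) :
    |(#{n ∈ Icc 1 X | P n} : ℝ) - X * (#{n ∈ range q | P n} / q : ℝ)| ≤ q := by
  set c := #{n ∈ range q | P n} with hc
  have hcq : c ≤ q := (card_filter_le _ _).trans (card_range q).le
  have hblock : ∀ n, #{i ∈ Ico n (n + q) | P i} = c := fun n => by
    rw [Nat.filter_Ico_card_eq_of_periodic n q P hP, Nat.count_eq_card_filter_range]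
  have hmul : ∀ k, #{i ∈ Ico 1 (1 + q * k) | P i} = k * c := by
    intro k
    induction k with
    | zero => simp
    | succ k ih =>
      have h1 : Ico 1 (1 + q * (k + 1)) = Ico 1 (1 + q * k) ∪ Ico (1 + q * k) (1 + q * k + q) := by
        rw [Ico_union_Ico_eq_Ico (by omega) (by omega)]
        congr 1
        ring
      rw [h1, filter_union, card_union_of_disjoint, ih, hblock]
      · ring
      · exact disjoint_filter_filter (Ico_disjoint_Ico_consecutive _ _ _)
  set k := X / q
  set r := X % q
  have hX : q * k + r = X := Nat.div_add_mod X q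
  have hr : r < q := Nat.mod_lt _ hq
  have h2 : Icc 1 X = Ico 1 (1 + q * k) ∪ Ico (1 + q * k) (1 + q * k + r) := by
    rw [Ico_union_Ico_eq_Ico (by omega) (by omega)]
    ext i
    simp only [mem_Icc, mem_Ico]
    omega
  have h3 : #{n ∈ Icc 1 X | P n} = k * c + #{i ∈ Ico (1 + q * k) (1 + q * k + r) | P i} := by
    rw [h2, filter_union, card_union_of_disjoint, hmul]
    exact disjoint_filter_filter (Ico_disjoint_Ico_consecutive _ _ _)
  have h4 : #{i ∈ Ico (1 + q * k) (1 + q * k + r) | P i} ≤ r :=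
    (card_filter_le _ _).trans (by simp)
  set e := #{i ∈ Ico (1 + q * k) (1 + q * k + r) | P i}
  have hq' : (0 : ℝ) < q := by exact_mod_cast hq
  have h5 : (X : ℝ) * (c / q : ℝ) = k * c + r * (c / q) := by
    have : (X : ℝ) = q * k + r := by exact_mod_cast hX.symm
    rw [this]
    field_simp
  have h6 : (0 : ℝ) ≤ c / q := by positivity
  have h7 : (c / q : ℝ) ≤ 1 := (div_le_one hq').2 (by exact_mod_cast hcq)
  have h8 : (r : ℝ) ≤ q := by exact_mod_cast hr.le
  have h9 : (e : ℝ) ≤ r := by exact_mod_cast h4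
  have h10 : (0 : ℝ) ≤ e := by positivity
  have h11 : (0 : ℝ) ≤ r := by positivity
  rw [h3, h5, abs_le]
  push_cast
  constructor <;> nlinarith

/-- Periodic conditions of coprime periods are independent. -/
theorem card_and_of_coprime (P Q : ℕ → Prop) [DecidablePred P] [DecidablePred Q]
    {a b : ℕ} (hab : a.Coprime b) (ha : 0 < a)
    (hb : 0 < b) (hP : Periodic P a) (hQ : Periodic Q b) :
    #{n ∈ range (a * b) | P n ∧ Q n} = #{n ∈ range a | P n} * #{n ∈ range b | Q n} := by
  rw [← card_product]
  refine card_bij (fun n _ => (n % a, n % b)) ?_ ?_ ?_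
  · intro n hn
    simp only [mem_filter, mem_range, mem_product] at hn ⊢
    exact ⟨⟨Nat.mod_lt _ ha, by rw [hP.map_mod_nat]; exact hn.2.1⟩,
      Nat.mod_lt _ hb, by rw [hQ.map_mod_nat]; exact hn.2.2⟩
  · intro n hn m hm h
    simp only [mem_filter, mem_range] at hn hm
    have h1 : n ≡ m [MOD a] := congrArg Prod.fst h
    have h2 : n ≡ m [MOD b] := congrArg Prod.snd h
    exact Nat.ModEq.eq_of_lt_of_lt ((Nat.modEq_and_modEq_iff_modEq_mul hab).1 ⟨h1, h2⟩) hn.1 hm.1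
  · rintro ⟨i, j⟩ hij
    simp only [mem_filter, mem_range, mem_product] at hij
    obtain ⟨⟨hi, hPi⟩, hj, hQj⟩ := hij
    have h1 := (Nat.chineseRemainder hab i j).2
    have hmi : (Nat.chineseRemainder hab i j : ℕ) % a = i := Eq.trans h1.1 (Nat.mod_eq_of_lt hi)
    have hmj : (Nat.chineseRemainder hab i j : ℕ) % b = j := Eq.trans h1.2 (Nat.mod_eq_of_lt hj)
    refine ⟨Nat.chineseRemainder hab i j, ?_, by simp only [hmi, hmj]⟩
    simp only [mem_filter, mem_range]
    refine ⟨Nat.chineseRemainder_lt_mul hab i j ha.ne' hb.ne', ?_, ?_⟩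
    · rw [← hP.map_mod_nat, hmi]; exact hPi
    · rw [← hQ.map_mod_nat, hmj]; exact hQj

open Classical in
theorem card_forall_of_coprime {ι : Type*} (A : Finset ι) (P : ι → ℕ → Prop) (q : ι → ℕ)
    (hq : ∀ i ∈ A, 0 < q i) (hP : ∀ i ∈ A, Periodic (P i) (q i))
    (hc : (A : Set ι).Pairwise fun i j => (q i).Coprime (q j)) :
    Periodic (fun n => ∀ i ∈ A, P i n) (∏ i ∈ A, q i) ∧
    #{n ∈ range (∏ i ∈ A, q i) | ∀ i ∈ A, P i n} = ∏ i ∈ A, #{n ∈ range (q i) | P i n} := by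
  induction A using Finset.induction_on with
  | empty => simp [Periodic]
  | insert i A hi ih =>
    have ih' := ih (fun j hj => hq j (mem_insert_of_mem hj))
      (fun j hj => hP j (mem_insert_of_mem hj)) (hc.mono (by simp))
    have hqi := hq i (mem_insert_self _ _)
    have hPi := hP i (mem_insert_self _ _)
    have hcop : (q i).Coprime (∏ j ∈ A, q j) := Nat.Coprime.prod_right fun j hj =>
      hc (by simp) (by simp [hj]) fun h => hi (h ▸ hj)
    have hpos : 0 < ∏ j ∈ A, q j := prod_pos fun j hj => hq j (mem_insert_of_mem hj)
    have h1 : (fun n => ∀ j ∈ insert i A, P j n) = fun n => P i n ∧ ∀ j ∈ A, P j n := by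
      funext n
      exact propext (forall_mem_insert _ _ _)
    rw [prod_insert hi]
    constructor
    · rw [h1]
      intro n
      have e1 : P i (n + q i * ∏ j ∈ A, q j) = P i n := by
        have := hPi.nat_mul (∏ j ∈ A, q j) n
        rwa [Nat.cast_id, mul_comm] at this
      have e2 : (∀ j ∈ A, P j (n + q i * ∏ j ∈ A, q j)) = (∀ j ∈ A, P j n) := by
        have := ih'.1.nat_mul (q i) n
        simpa only [Nat.cast_id] using this
      simp only [e1, e2]
    · rw [prod_insert hi, ← ih'.2, ← card_and_of_coprime _ _ hcop hqi hpos hPi ih'.1]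
      simp only [forall_mem_insert]

end PeriodicCount

namespace BNumbers

open Finset Function

/-- Some linear form `a m * n + b m` is divisible by `p` but not by `p ^ 2`. -/
def ExactlyDividesSome {M : ℕ} (a b : Fin M → ℤ) (p n : ℕ) : Prop :=
  ∃ m, (p : ℤ) ∣ a m * n + b m ∧ ¬ ((p ^ 2 : ℕ) : ℤ) ∣ a m * n + b m

theorem periodic_dvd_linear (a b : ℤ) {d q : ℕ} (h : d ∣ q) :
    Periodic (fun n : ℕ => (d : ℤ) ∣ a * n + b) q := by
  intro n
  have h1 : a * ((n + q : ℕ) : ℤ) + b = (a * n + b) + a * q := by push_cast; ring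
  have h2 : (d : ℤ) ∣ a * q := (Int.natCast_dvd_natCast.2 h).mul_left a
  simp only [h1]
  exact propext (dvd_add_left h2)

theorem periodic_exactlyDividesSome {M : ℕ} (a b : Fin M → ℤ) (p : ℕ) :
    Periodic (ExactlyDividesSome a b p) (p ^ 2) := by
  intro n
  have h1 := fun m => periodic_dvd_linear (a m) (b m) (d := p) (q := p ^ 2)
    (dvd_pow_self _ two_ne_zero) n
  have h2 := fun m => periodic_dvd_linear (a m) (b m) (d := p ^ 2) (q := p ^ 2) dvd_rfl n
  simp only [ExactlyDividesSome, h1, h2]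

open Classical in
theorem card_dvd_linear (a b : ℤ) {d q : ℕ} (hd : 0 < d) (h : d ∣ q) (hc : IsCoprime a (d : ℤ)) :
    #{n ∈ range q | (d : ℤ) ∣ a * (n : ℕ) + b} = q / d := by
  obtain ⟨u, v, huv⟩ := hc
  have hd' : (0 : ℤ) < d := by exact_mod_cast hd
  have hw : (((-u * b) % d).toNat : ℤ) = (-u * b) % d := Int.toNat_of_nonneg (Int.emod_nonneg _ hd'.ne')
  have key : ∀ n : ℕ, (d : ℤ) ∣ a * n + b ↔ n ≡ ((-u * b) % d).toNat [MOD d] := by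
    intro n
    rw [← Int.natCast_modEq_iff, hw, Int.ModEq, Int.emod_emod_of_dvd _ dvd_rfl, ← Int.ModEq,
      Int.modEq_comm, Int.modEq_iff_dvd]
    constructor
    · intro hh
      have : (n : ℤ) - -u * b = u * (a * n + b) + d * (v * n) := by linear_combination (-n : ℤ) * huv
      rw [this]
      exact dvd_add (hh.mul_left _) (dvd_mul_right _ _)
    · intro hh
      have : a * n + b = a * (n - -u * b) + d * (v * b) := by linear_combination (-b) * huv
      rw [this]
      exact dvd_add (hh.mul_left _) (dvd_mul_right _ _)
  simp only [key]
  rw [← Nat.count_eq_card_filter_range, Nat.count_modEq_card _ hd, Nat.mod_eq_zero_of_dvd h]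
  simp

open Classical in
theorem card_exactlyDividesSome {M : ℕ} (a b : Fin M → ℤ) {p : ℕ} (hp : p.Prime)
    (ha : ∀ m, ¬ (p : ℤ) ∣ a m) (hab : ∀ m k, m ≠ k → ¬ (p : ℤ) ∣ a m * b k - a k * b m) :
    #{n ∈ range (p ^ 2) | ExactlyDividesSome a b p n} = M * (p - 1) := by
  have hpp : _root_.Prime (p : ℤ) := Nat.prime_iff_prime_int.1 hp
  have h1 : {n ∈ range (p ^ 2) | ExactlyDividesSome a b p n} =
      (univ : Finset (Fin M)).biUnion fun m => {n ∈ range (p ^ 2) |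
        (p : ℤ) ∣ a m * (n : ℕ) + b m ∧ ¬ ((p ^ 2 : ℕ) : ℤ) ∣ a m * n + b m} := by
    ext n
    rw [mem_filter, mem_biUnion]
    simp only [mem_filter, mem_univ, true_and]
    exact exists_and_left.symm
  rw [h1, card_biUnion]
  · have h2 : ∀ m ∈ (univ : Finset (Fin M)), #{n ∈ range (p ^ 2) |
        (p : ℤ) ∣ a m * (n : ℕ) + b m ∧ ¬ ((p ^ 2 : ℕ) : ℤ) ∣ a m * n + b m} = p - 1 := by
      intro m _
      have hc : IsCoprime (a m) (p : ℤ) := ((hpp.coprime_iff_not_dvd).2 (ha m)).symm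
      have e1 := card_dvd_linear (a m) (b m) (d := p) (q := p ^ 2) hp.pos
        (dvd_pow_self _ two_ne_zero) hc
      have e2 := card_dvd_linear (a m) (b m) (d := p ^ 2) (q := p ^ 2) (pow_pos hp.pos 2)
        dvd_rfl (by push_cast; exact hc.pow_right)
      rw [Nat.div_self (pow_pos hp.pos 2)] at e2
      rw [sq, Nat.mul_div_cancel _ hp.pos, ← sq] at e1
      refine Eq.trans ?_ ((card_sdiff_of_subset ?_).trans (congrArg₂ (· - ·) e1 e2))
      · congr 1
        ext n
        simp only [mem_filter, mem_sdiff]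
        tauto
      · intro n hn
        simp only [mem_filter] at hn ⊢
        refine ⟨hn.1, dvd_trans ?_ hn.2⟩
        exact_mod_cast dvd_pow_self p two_ne_zero
    rw [sum_congr rfl h2]
    simp
  · intro m _ k _ hmk
    refine disjoint_left.2 fun n hm hk => hab m k hmk ?_
    have e1 := (mem_filter.1 hm).2.1
    have e2 := (mem_filter.1 hk).2.1
    have : a m * b k - a k * b m = a m * (a k * n + b k) - a k * (a m * n + b m) := by ring
    rw [this]
    exact dvd_sub (e2.mul_left _) (e1.mul_left _)

/-- The proportion of residue classes modulo `p ^ 2` for which one of `M` forms is exactly divisible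
by `p`. -/
noncomputable def exactDensity (M p : ℕ) : ℝ := M * (p - 1) / p ^ 2

open Classical in
theorem abs_card_exactlyDividesSome_sub_le {M : ℕ} (a b : Fin M → ℤ) (A : Finset ℕ)
    (hA : ∀ p ∈ A, p.Prime ∧ (∀ m, ¬ (p : ℤ) ∣ a m) ∧
      ∀ m k, m ≠ k → ¬ (p : ℤ) ∣ a m * b k - a k * b m) (X : ℕ) :
    |(#{n ∈ Icc 1 X | ∀ p ∈ A, ExactlyDividesSome a b p n} : ℝ)
      - X * ∏ p ∈ A, exactDensity M p| ≤ (∏ p ∈ A, (p : ℝ)) ^ 2 := by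
  obtain ⟨h1, h2⟩ := PeriodicCount.card_forall_of_coprime A (ExactlyDividesSome a b) (fun p => p ^ 2)
    (fun p hp => pow_pos (hA p hp).1.pos 2) (fun p _ => periodic_exactlyDividesSome a b p)
    (fun p hp r hr hpr => Nat.Coprime.pow 2 2 ((Nat.coprime_primes (hA p hp).1 (hA r hr).1).2 hpr))
  have h3 := PeriodicCount.abs_card_sub_le _
    (prod_pos fun p hp => pow_pos (hA p hp).1.pos 2) h1 X
  rw [h2] at h3
  have h4 : ((∏ p ∈ A, #{n ∈ range (p ^ 2) | ExactlyDividesSome a b p n} : ℕ) : ℝ) /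
      ((∏ p ∈ A, p ^ 2 : ℕ) : ℝ) = ∏ p ∈ A, exactDensity M p := by
    rw [Nat.cast_prod, Nat.cast_prod, ← prod_div_distrib]
    refine prod_congr rfl fun p hp => ?_
    rw [card_exactlyDividesSome a b (hA p hp).1 (hA p hp).2.1 (hA p hp).2.2, exactDensity]
    push_cast [Nat.cast_sub (hA p hp).1.one_le]
    rfl
  rw [h4, Nat.cast_prod] at h3
  push_cast at h3
  rwa [prod_pow] at h3

end BNumbers

namespace PrimeSums

open Finset Real

theorem sum_inv_sq_le (A : Finset ℕ) : ∑ n ∈ A, 1 / (n : ℝ) ^ 2 ≤ ∑' n : ℕ, 1 / (n : ℝ) ^ 2 :=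
  (Real.summable_one_div_nat_pow.2 one_lt_two).sum_le_tsum _ fun _ _ => by positivity

/-- An upper bound in Mertens' first theorem. -/
theorem sum_log_div_le {n : ℕ} (hn : 1 ≤ n) :
    ∑ p ∈ Nat.primesLE n, log p / p ≤ log n + log 4 := by
  have hn0 : (0 : ℝ) < n := by exact_mod_cast hn
  have hdvd : ∏ p ∈ Nat.primesLE n, p ^ (n / p) ∣ n.factorial := by
    refine Finset.prod_dvd_of_isRelPrime ?_ ?_
    · intro p hp q hq hpq
      exact Nat.coprime_iff_isRelPrime.1 (Nat.Coprime.pow _ _ ((Nat.coprime_primes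
        (Nat.mem_primesLE.1 hp).2 (Nat.mem_primesLE.1 hq).2).2 hpq))
    · intro p hp
      have hp' := (Nat.mem_primesLE.1 hp).2
      refine (hp'.pow_dvd_factorial_iff (Nat.lt_succ_self (Nat.log p n))).2 ?_
      have h1 : (1 : ℕ) ∈ Ico 1 (Nat.log p n).succ := by
        have := Nat.log_pos hp'.one_lt (Nat.mem_primesLE.1 hp).1
        simp only [mem_Ico]
        omega
      refine le_trans (by rw [pow_one]) (single_le_sum (fun _ _ => Nat.zero_le _) h1)
  have h1 : log (∏ p ∈ Nat.primesLE n, p ^ (n / p) : ℕ) ≤ n * log n := by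
    have h2 : (∏ p ∈ Nat.primesLE n, p ^ (n / p) : ℕ) ≤ n ^ n :=
      (Nat.le_of_dvd (Nat.factorial_pos n) hdvd).trans (Nat.factorial_le_pow n)
    have h3 : 0 < (∏ p ∈ Nat.primesLE n, p ^ (n / p) : ℕ) :=
      prod_pos fun p hp => pow_pos (Nat.mem_primesLE.1 hp).2.pos _
    rw [← log_pow]
    exact log_le_log (by exact_mod_cast h3) (by exact_mod_cast h2)
  have h4 : log (∏ p ∈ Nat.primesLE n, p ^ (n / p) : ℕ)
      = ∑ p ∈ Nat.primesLE n, ((n / p : ℕ) : ℝ) * log p := by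
    push_cast
    rw [log_prod]
    · simp_rw [log_pow]
    · intro p hp
      have := (Nat.mem_primesLE.1 hp).2.pos
      positivity
  have h5 : ∑ p ∈ Nat.primesLE n, (n * (log p / p) - log p)
      ≤ ∑ p ∈ Nat.primesLE n, ((n / p : ℕ) : ℝ) * log p := by
    refine sum_le_sum fun p hp => ?_
    have hp' := (Nat.mem_primesLE.1 hp).2
    have hlog : 0 ≤ log p := log_natCast_nonneg p
    have h6 : (n : ℝ) / p ≤ (n / p : ℕ) + 1 := by
      rw [← Nat.floor_div_eq_div (K := ℝ)]
      exact (Nat.lt_floor_add_one _).le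
    have : n * (log p / p) - log p = (n / p - 1) * log p := by ring
    rw [this]
    exact mul_le_mul_of_nonneg_right (by linarith) hlog
  rw [sum_sub_distrib, ← mul_sum, ← Chebyshev.theta_eq_sum_primesLE_log] at h5
  have h7 := Chebyshev.theta_le_log4_mul_x hn0.le
  rw [← mul_le_mul_iff_right₀ hn0]
  linarith

/-- A lower bound in Mertens' second theorem. -/
theorem log_log_le_sum_inv {n : ℕ} (hn : 2 ≤ n) :
    log (log n) - 2 * ∑' k : ℕ, 1 / (k : ℝ) ^ 2 ≤ ∑ p ∈ Nat.primesLE n, 1 / (p : ℝ) := by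
  have hn1 : (1 : ℝ) < n := by exact_mod_cast hn
  let f : ℕ →* ℝ :=
    { toFun := fun k => (k : ℝ)⁻¹
      map_one' := by simp
      map_mul' := fun a b => by push_cast; rw [mul_inv] }
  have hf : ∀ {p : ℕ}, p.Prime → ‖f p‖ < 1 := fun {p} hp => by
    change ‖(p : ℝ)⁻¹‖ < 1
    rw [norm_inv, Real.norm_natCast]
    exact inv_lt_one_of_one_lt₀ (by exact_mod_cast hp.one_lt)
  obtain ⟨hs, hsum⟩ := EulerProduct.summable_and_hasSum_smoothNumbers_prod_primesBelow_geometric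
    hf (n + 1)
  have h1 : log n ≤ ∏ p ∈ Nat.primesBelow (n + 1), (1 - f p)⁻¹ := by
    have h2 : ∑ k ∈ Icc 1 n, (k : ℝ)⁻¹ ≤ ∏ p ∈ Nat.primesBelow (n + 1), (1 - f p)⁻¹ := by
      have hmem : ∀ k ∈ Icc 1 n, k ∈ Nat.smoothNumbers (n + 1) := fun k hk => by
        rw [mem_Icc] at hk
        exact Nat.mem_smoothNumbers_of_lt hk.1 (by omega)
      have h3 := sum_le_hasSum ((Icc 1 n).subtype (· ∈ Nat.smoothNumbers (n + 1)))
        (fun i _ => by change (0 : ℝ) ≤ ((i : ℕ) : ℝ)⁻¹; positivity) hsum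
      refine le_trans (le_of_eq ?_) h3
      rw [sum_subtype_of_mem (fun k => f k) hmem]
      rfl
    refine le_trans ?_ h2
    have h3 := log_add_one_le_harmonic n
    have h4 : ((harmonic n : ℚ) : ℝ) = ∑ k ∈ Icc 1 n, (k : ℝ)⁻¹ := by
      rw [harmonic_eq_sum_Icc]
      push_cast
      rfl
    rw [h4] at h3
    refine le_trans (log_le_log (by linarith) ?_) h3
    push_cast
    linarith
  have h5 : ∏ p ∈ Nat.primesBelow (n + 1), (1 - f p)⁻¹ ≤
      exp (∑ p ∈ Nat.primesLE n, (1 / (p : ℝ) + 2 * (1 / (p : ℝ) ^ 2))) := by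
    rw [exp_sum]
    change ∏ p ∈ Nat.primesLE n, _ ≤ _
    have hu : ∀ p ∈ Nat.primesLE n, 0 < f p ∧ f p ≤ 1 / 2 := fun p hp => by
      have h2 : (2 : ℝ) ≤ p := by exact_mod_cast (Nat.mem_primesLE.1 hp).2.two_le
      change 0 < (p : ℝ)⁻¹ ∧ (p : ℝ)⁻¹ ≤ 1 / 2
      exact ⟨by positivity, by rw [one_div]; exact inv_anti₀ two_pos h2⟩
    refine prod_le_prod (fun p hp => ?_) fun p hp => ?_
    · have := hu p hp
      exact inv_nonneg.2 (by linarith)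
    · obtain ⟨h0, h2⟩ := hu p hp
      have e : 1 / (p : ℝ) + 2 * (1 / (p : ℝ) ^ 2) = f p + 2 * f p ^ 2 := by
        change _ = (p : ℝ)⁻¹ + 2 * ((p : ℝ)⁻¹) ^ 2
        rw [one_div, one_div, inv_pow]
      rw [e]
      refine le_trans ?_ (add_one_le_exp _)
      rw [inv_le_iff_one_le_mul₀ (by linarith)]
      nlinarith [mul_nonneg (sq_nonneg (f p)) (by linarith : 0 ≤ 1 / 2 - f p)]
  have h6 := log_le_log (log_pos hn1) (h1.trans h5)
  rw [log_exp, sum_add_distrib, ← mul_sum] at h6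
  have := sum_inv_sq_le (Nat.primesLE n)
  linarith

/-- An upper bound for an Euler product at `1 + 1 / log n` over a set of primes up to `n` bounds
the sum of the reciprocals of these primes. -/
theorem sum_inv_le_of_prod_le {n : ℕ} (hn : 2 ≤ n) {S : Finset ℕ} (hS : S ⊆ Nat.primesLE n) {N : ℕ}
    (hN : 0 < N) {C : ℝ} (hC : 0 < C)
    (h : ∏ p ∈ S, (1 + (p : ℝ) ^ (-(1 + 1 / log n))) ^ N ≤ C * log n) :
    ∑ p ∈ S, 1 / (p : ℝ) ≤ 1 / N * log (log n) +
      (|log C| + 1 + log 4 / log 2 + ∑' k : ℕ, 1 / (k : ℝ) ^ 2) := by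
  have hn1 : (1 : ℝ) < n := by exact_mod_cast hn
  have hl : 0 < log n := log_pos hn1
  have hl2 : log 2 ≤ log n := log_le_log two_pos (by exact_mod_cast hn)
  have hN' : (1 : ℝ) ≤ N := by exact_mod_cast hN
  set s := 1 + 1 / log n with hs
  have hs1 : 1 < s := by rw [hs]; have : 0 < 1 / log n := by positivity
                         linarith
  have hlow : ∀ p ∈ S, 1 / (p : ℝ) - 1 / log n * (log p / p) - 1 / (p : ℝ) ^ 2 ≤
      log (1 + (p : ℝ) ^ (-s)) := by
    intro p hp
    have hp' := (Nat.mem_primesLE.1 (hS hp)).2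
    have hp0 : (0 : ℝ) < p := by exact_mod_cast hp'.pos
    have hp1 : (1 : ℝ) ≤ p := by exact_mod_cast hp'.one_le
    set u := (p : ℝ) ^ (-s) with hu
    have hu0 : 0 < u := rpow_pos_of_pos hp0 _
    have hu1 : u ≤ 1 / p := by
      have := rpow_le_rpow_of_exponent_le hp1 (show -s ≤ -1 by linarith)
      rwa [rpow_neg_one, ← one_div] at this
    have hu2 : 1 / (p : ℝ) - 1 / log n * (log p / p) ≤ u := by
      have e : u = 1 / p * exp (-(log p / log n)) := by
        rw [hu, rpow_def_of_pos hp0, hs, show log p * -(1 + 1 / log n)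
          = -log p + -(log p / log n) by ring, exp_add, exp_neg, exp_log hp0, one_div]
      rw [e]
      have h1 := add_one_le_exp (-(log p / log n))
      have h2 : 1 / (p : ℝ) - 1 / log n * (log p / p) = 1 / p * (-(log p / log n) + 1) := by ring
      rw [h2]
      exact mul_le_mul_of_nonneg_left h1 (by positivity)
    have h1 := one_sub_inv_le_log_of_pos (show 0 < 1 + u by linarith)
    have h2 : u - u ^ 2 ≤ 1 - (1 + u)⁻¹ := by
      have : (1 + u)⁻¹ ≤ 1 - u + u ^ 2 := by
        rw [inv_le_iff_one_le_mul₀ (by linarith)]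
        nlinarith [pow_pos hu0 3]
      linarith
    have h3 : u ^ 2 ≤ 1 / (p : ℝ) ^ 2 := by
      rw [← one_div_pow]
      exact pow_le_pow_left₀ hu0.le hu1 2
    linarith
  have hfac : ∀ p ∈ S, 0 < 1 + (p : ℝ) ^ (-s) := fun p _ => by positivity
  have h1 : N * ∑ p ∈ S, log (1 + (p : ℝ) ^ (-s)) ≤ log C + log (log n) := by
    rw [← log_mul hC.ne' hl.ne']
    refine le_trans (le_of_eq ?_) (log_le_log (prod_pos fun p hp => pow_pos (hfac p hp) N) h)
    rw [log_prod fun p hp => (pow_pos (hfac p hp) N).ne', mul_sum]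
    simp_rw [log_pow]
  have h2 := sum_le_sum hlow
  rw [sum_sub_distrib, sum_sub_distrib, ← mul_sum] at h2
  have h3 : ∑ p ∈ S, log p / p ≤ log n + log 4 :=
    (sum_le_sum_of_subset_of_nonneg hS fun p _ _ =>
      div_nonneg (log_natCast_nonneg p) (Nat.cast_nonneg p)).trans (sum_log_div_le (by omega))
  have h4 : 1 / log n * ∑ p ∈ S, log p / p ≤ 1 + log 4 / log 2 := by
    calc _ ≤ 1 / log n * (log n + log 4) := mul_le_mul_of_nonneg_left h3 (by positivity)
      _ = 1 + log 4 / log n := by field_simp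
      _ ≤ _ := by gcongr
  have h5 := sum_inv_sq_le S
  have h6 : ∑ p ∈ S, log (1 + (p : ℝ) ^ (-s)) ≤ 1 / N * log (log n) + |log C| := by
    have hN0 : (0 : ℝ) < N := by linarith
    have : ∑ p ∈ S, log (1 + (p : ℝ) ^ (-s)) ≤ (log C + log (log n)) / N := by
      rw [le_div_iff₀ hN0]
      linarith
    refine this.trans ?_
    have h7 : log C / N ≤ |log C| :=
      (div_le_div_of_nonneg_right (le_abs_self _) hN0.le).trans
        (div_le_self (abs_nonneg _) hN')
    rw [add_div, one_div_mul_eq_div]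
    linarith
  linarith

end PrimeSums

namespace BNumbers

open Finset Ideal

variable (K : Type*) [Field K] [NumberField K]

theorem exists_primes_of_not_dvd_discr [Normal ℚ K] {p : ℕ} (hp : p.Prime)
    (hd : ¬ (p : ℤ) ∣ discr K) :
    ∃ (r : ℕ) (T : Finset (Ideal (𝓞 K))), 0 < r ∧ r * #T = Module.finrank ℚ K ∧
      (∀ P ∈ T, P.IsPrime ∧ absNorm P = p ^ r) ∧ Ideal.span {(p : 𝓞 K)} = ∏ P ∈ T, P := by
  have hpZ : _root_.Prime (p : ℤ) := Nat.prime_iff_prime_int.1 hp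
  have : IsGalois ℚ K := ⟨⟩
  have hpr : (Ideal.span {(p : ℤ)}).IsPrime :=
    (Ideal.span_singleton_prime hpZ.ne_zero).2 hpZ
  have hbot : Ideal.span {(p : ℤ)} ≠ ⊥ := by simpa using hpZ.ne_zero
  have hmax : (Ideal.span {(p : ℤ)}).IsMaximal := hpr.isMaximal hbot
  have hunr := (not_dvd_discr_iff_isUnramifiedIn K (𝓞 K) hpZ).1 hd
  let _ : Fintype (primesOver (Ideal.span {(p : ℤ)}) (𝓞 K)) :=
    (Algebra.QuasiFinite.finite_primesOver _).fintype
  obtain ⟨⟨P₀, hP₀, hP₀'⟩⟩ :=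
    (inferInstance : Nonempty (primesOver (Ideal.span {(p : ℤ)}) (𝓞 K)))
  have hT : ∀ P, P ∈ (primesOver (Ideal.span {(p : ℤ)}) (𝓞 K)).toFinset ↔
      P.IsPrime ∧ P.LiesOver (Ideal.span {(p : ℤ)}) := fun P => Set.mem_toFinset
  refine ⟨inertiaDegIn (Ideal.span {(p : ℤ)}) (𝓞 K),
    (primesOver (Ideal.span {(p : ℤ)}) (𝓞 K)).toFinset, ?_, ?_, ?_, ?_⟩
  · exact Nat.pos_of_ne_zero (inertiaDegIn_ne_zero Gal(K/ℚ))
  · have h := ncard_primesOver_mul_ramificationIdxIn_mul_inertiaDegIn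
      (Ideal.span {(p : ℤ)}) (𝓞 K) Gal(K/ℚ)
    rw [ramificationIdxIn_eq_ramificationIdx _ P₀ Gal(K/ℚ), hunr.ramificationIdx_eq_one hP₀',
      one_mul, IsGaloisGroup.card_eq_finrank Gal(K/ℚ) ℚ K, Set.ncard_eq_toFinset_card'] at h
    rw [← h, mul_comm]
  · intro P hP
    obtain ⟨h1, h2⟩ := (hT P).1 hP
    refine ⟨h1, ?_⟩
    rw [inertiaDegIn_eq_inertiaDeg _ P Gal(K/ℚ), ← absNorm_pow_inertiaDeg (Ideal.span {(p : ℤ)}) P]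
    simp
  · have h := Ideal.map_algebraMap_eq_finsetProd_pow (R := 𝓞 K) (p := Ideal.span {(p : ℤ)}) hbot
    rw [Ideal.map_span, Set.image_singleton] at h
    simp only [algebraMap_int_eq, map_natCast] at h
    rw [h]
    refine prod_congr rfl fun P hP => ?_
    obtain ⟨h1, h2⟩ := (hT P).1 hP
    rw [hunr.ramificationIdx_eq_one h2, pow_one]

/-- An unramified prime outside `nonsplitPrimes K` splits completely. -/
theorem exists_primes_of_notMem_nonsplitPrimes [Normal ℚ K] {p : ℕ} (hp : p.Prime)
    (hd : ¬ (p : ℤ) ∣ discr K) (hs : p ∉ nonsplitPrimes K) :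
    ∃ T : Finset (Ideal (𝓞 K)), #T = Module.finrank ℚ K ∧ ∀ P ∈ T, P.IsPrime ∧ absNorm P = p := by
  obtain ⟨r, T, hr, hrT, hT, hprod⟩ := exists_primes_of_not_dvd_discr K hp hd
  have h1 : r = 1 := by
    by_contra hne
    refine hs ⟨r, by omega, hp, ⟨_, hrT.symm⟩, T, ?_, hT, hprod⟩
    rw [← hrT, Nat.mul_div_cancel_left _ hr]
  subst h1
  exact ⟨T, by simpa using hrT, by simpa using hT⟩

/-- A prime which is inert in part never divides the norm of an ideal exactly once. -/
theorem sq_dvd_absNorm_of_mem_nonsplitPrimes {p : ℕ} (hp : p ∈ nonsplitPrimes K)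
    {I : Ideal (𝓞 K)} (h : p ∣ absNorm I) : p ^ 2 ∣ absNorm I := by
  obtain ⟨r, hr, hpp, -, s, -, hs, hprod⟩ := hp
  obtain ⟨P, hP, hPp, hPI⟩ := exists_isMaximal_dvd_of_dvd_absNorm' hpp I h
  have hmem : (p : 𝓞 K) ∈ P := by
    have : (p : ℤ) ∈ P.under ℤ := hPp ▸ Ideal.mem_span_singleton_self _
    simpa [Ideal.under] using this
  have hle : ∏ Q ∈ s, Q ≤ P := by
    rw [← hprod, Ideal.span_singleton_le_iff_mem]
    exact hmem
  obtain ⟨Q, hQ, hQP⟩ := (hP.isPrime.prod_le).1 hle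
  have hPQ : absNorm P = p ^ r := by
    have hQm : Q.IsMaximal := by
      refine (hs Q hQ).1.isMaximal fun hbot => ?_
      have := (hs Q hQ).2
      rw [hbot, absNorm_bot] at this
      exact (pow_pos hpp.pos r).ne this
    rw [← hQm.eq_of_le hP.ne_top hQP]
    exact (hs Q hQ).2
  exact (pow_dvd_pow p hr).trans (hPQ ▸ absNorm_dvd_absNorm_of_le (dvd_iff_le.1 hPI))

theorem idealNormIndicator_le_one (n : ℤ) : idealNormIndicator K n ≤ 1 := by
  unfold idealNormIndicator
  split_ifs <;> simp

theorem idealNormIndicator_eq_zero {p : ℕ} (hp : p ∈ nonsplitPrimes K) {n : ℤ}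
    (h1 : (p : ℤ) ∣ n) (h2 : ¬ ((p ^ 2 : ℕ) : ℤ) ∣ n) : idealNormIndicator K n = 0 := by
  unfold idealNormIndicator
  rw [if_neg]
  rintro ⟨I, -, rfl⟩
  exact h2 (Int.natCast_dvd_natCast.2
    (sq_dvd_absNorm_of_mem_nonsplitPrimes K hp (Int.natCast_dvd_natCast.1 h1)))

/-- Near `1`, the partial sums of the Dirichlet series of the Dedekind zeta function are bounded by
a multiple of `1 / (s - 1)`. -/
theorem exists_sum_card_le :
    ∃ C : ℝ, 0 < C ∧ ∀ᶠ s : ℝ in nhdsWithin 1 (Set.Ioi 1), ∀ t : Finset ℕ, 0 ∉ t →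
      ∑ n ∈ t, (Nat.card {I : Ideal (𝓞 K) // absNorm I = n} : ℝ) * (n : ℝ) ^ (-s)
        ≤ C / (s - 1) := by
  have hres := dedekindZeta_residue_pos K
  refine ⟨dedekindZeta_residue K + 1, by positivity, ?_⟩
  have hlim := (tendsto_sub_one_mul_dedekindZeta_nhdsGT K).norm
  rw [Complex.norm_real, Real.norm_of_nonneg hres.le] at hlim
  filter_upwards [hlim.eventually_const_lt hres, hlim.eventually_le_const (lt_add_one _),
    self_mem_nhdsWithin] with s hs1 hs2 hs3 t ht
  have hs3' : (0 : ℝ) < s - 1 := sub_pos.2 hs3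
  set c : ℕ → ℝ := fun n => Nat.card {I : Ideal (𝓞 K) // absNorm I = n} with hc
  let f : ℕ → ℝ := fun n => if n = 0 then 0 else c n * (n : ℝ) ^ (-s)
  have hf0 : ∀ n, 0 ≤ f n := fun n => by
    simp only [f]
    split_ifs <;> positivity
  have hterm : ∀ n, LSeries.term (fun n ↦ (Nat.card {I : Ideal (𝓞 K) // absNorm I = n} : ℂ)) s n
      = ((f n : ℝ) : ℂ) := by
    intro n
    by_cases hn : n = 0
    · simp [hn, f]
    · rw [LSeries.term_of_ne_zero hn]
      simp only [f, if_neg hn]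
      rw [Complex.ofReal_mul, Complex.ofReal_cpow (Nat.cast_nonneg n), Complex.ofReal_neg,
        Complex.cpow_neg, div_eq_mul_inv]
      simp [c]
  have hzeta : dedekindZeta K s = ((∑' n, f n : ℝ) : ℂ) := by
    rw [dedekindZeta, LSeries, Complex.ofReal_tsum]
    exact tsum_congr hterm
  rw [hzeta, norm_mul, ← Complex.ofReal_one, ← Complex.ofReal_sub, Complex.norm_real,
    Complex.norm_real, Real.norm_of_nonneg hs3'.le, Real.norm_of_nonneg (tsum_nonneg hf0)] at hs1 hs2
  have hsum : Summable f := by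
    by_contra h
    rw [tsum_eq_zero_of_not_summable h, mul_zero] at hs1
    exact lt_irrefl _ hs1
  calc _ = ∑ n ∈ t, f n := sum_congr rfl fun n hn => by
        simp only [f, if_neg (fun h => ht (h ▸ hn) : n ≠ 0)]
        rfl
    _ ≤ ∑' n, f n := hsum.sum_le_tsum _ fun n _ => hf0 n
    _ ≤ _ := by rw [le_div_iff₀ hs3', mul_comm]; exact hs2

theorem sum_absNorm_le_sum_card (F : Finset (Ideal (𝓞 K))) (s : ℝ) :
    ∑ I ∈ F, (absNorm I : ℝ) ^ (-s) ≤ ∑ n ∈ F.image (fun I => absNorm I),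
      (Nat.card {I : Ideal (𝓞 K) // absNorm I = n} : ℝ) * (n : ℝ) ^ (-s) := by
  classical
  rw [← sum_fiberwise_of_maps_to (g := fun I => absNorm I) (t := F.image fun I => absNorm I)
    fun I hI => mem_image_of_mem _ hI]
  refine sum_le_sum fun n _ => ?_
  rw [sum_congr rfl fun I hI => by rw [(mem_filter.1 hI).2], sum_const, nsmul_eq_mul]
  refine mul_le_mul_of_nonneg_right ?_ (Real.rpow_nonneg (Nat.cast_nonneg n) _)
  have hfin := finite_setOfPred_absNorm_eq (S := 𝓞 K) n
  have : #{I ∈ F | absNorm I = n} ≤ Nat.card {I : Ideal (𝓞 K) // absNorm I = n} := by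
    change _ ≤ Nat.card ↑{I : Ideal (𝓞 K) | absNorm I = n}
    rw [Nat.card_coe_set_eq, ← Set.ncard_coe_finset]
    exact Set.ncard_le_ncard (fun I hI => (mem_filter.1 (mem_coe.1 hI)).2) hfin
  exact_mod_cast this

/-- The partial Euler product over distinct primes is a sum over distinct ideals. -/
theorem prod_one_add_absNorm_eq (T : Finset (Ideal (𝓞 K)))
    (hT : ∀ P ∈ T, P.IsPrime ∧ P ≠ ⊥) (s : ℝ) :
    ∃ F : Finset (Ideal (𝓞 K)), (∀ I ∈ F, I ≠ ⊥) ∧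
      ∏ P ∈ T, (1 + (absNorm P : ℝ) ^ (-s)) = ∑ I ∈ F, (absNorm I : ℝ) ^ (-s) := by
  classical
  have hprime : ∀ P ∈ T, _root_.Prime P := fun P hP => prime_of_isPrime (hT P hP).2 (hT P hP).1
  have hsub : ∀ A ⊆ T, ∀ B ⊆ T, ∏ P ∈ A, P = ∏ P ∈ B, P → A ⊆ B := by
    intro A hA B hB h P hP
    have hPB : P ∣ ∏ Q ∈ B, Q := h ▸ dvd_prod_of_mem _ hP
    obtain ⟨Q, hQ, hPQ⟩ := ((hprime P (hA hP)).dvd_finsetProd_iff _).1 hPB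
    have := (hprime P (hA hP)).associated_of_dvd (hprime Q (hB hQ)) hPQ
    rwa [associated_iff_eq.1 this]
  refine ⟨T.powerset.image fun A => ∏ P ∈ A, P, ?_, ?_⟩
  · intro I hI
    obtain ⟨A, hA, rfl⟩ := mem_image.1 hI
    exact prod_ne_zero_iff.2 fun P hP => (hprime P (mem_powerset.1 hA hP)).ne_zero
  · rw [sum_image, prod_one_add]
    · refine sum_congr rfl fun A _ => ?_
      rw [map_prod, Nat.cast_prod, ← Real.finsetProd_rpow _ _ fun _ _ => Nat.cast_nonneg _]
    · intro A hA B hB h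
      rw [mem_coe, mem_powerset] at hA hB
      exact (hsub A hA B hB h).antisymm (hsub B hB A hA h.symm)

end BNumbers

namespace BNumbers

open Finset Ideal Filter Topology

variable (K : Type*) [Field K] [NumberField K]

open Classical in
/-- The primes up to `n` that split completely (away from the discriminant). -/
noncomputable def splitPrimesLE (n : ℕ) : Finset ℕ :=
  {p ∈ Nat.primesLE n | p ∉ nonsplitPrimes K ∧ ¬ (p : ℤ) ∣ discr K}

theorem prod_splitPrimesLE_le [Normal ℚ K] :
    ∃ C : ℝ, 0 < C ∧ ∀ᶠ n : ℕ in atTop,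
      ∏ p ∈ splitPrimesLE K n, (1 + (p : ℝ) ^ (-(1 + 1 / Real.log n))) ^ Module.finrank ℚ K
        ≤ C * Real.log n := by
  classical
  obtain ⟨C, hC, hev⟩ := exists_sum_card_le K
  refine ⟨C, hC, ?_⟩
  have hlog : Tendsto (fun n : ℕ => Real.log n) atTop atTop :=
    Real.tendsto_log_atTop.comp tendsto_natCast_atTop_atTop
  have hlim : Tendsto (fun n : ℕ => 1 + 1 / Real.log n) atTop (𝓝[>] 1) := by
    refine tendsto_nhdsWithin_iff.2 ⟨?_, ?_⟩
    · simpa using (hlog.inv_tendsto_atTop.const_add 1)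
    · filter_upwards [hlog.eventually_gt_atTop 0] with n hn
      exact lt_add_of_pos_right (1 : ℝ) (one_div_pos.2 hn)
  have hT : ∀ p : ℕ, ∃ T : Finset (Ideal (𝓞 K)), ∀ n, p ∈ splitPrimesLE K n →
      #T = Module.finrank ℚ K ∧ ∀ P ∈ T, P.IsPrime ∧ absNorm P = p := by
    intro p
    by_cases h : p.Prime ∧ p ∉ nonsplitPrimes K ∧ ¬ (p : ℤ) ∣ discr K
    · obtain ⟨T, hT⟩ := exists_primes_of_notMem_nonsplitPrimes K h.1 h.2.2 h.2.1
      exact ⟨T, fun _ _ => hT⟩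
    · refine ⟨∅, fun n hn => absurd ?_ h⟩
      have := mem_filter.1 hn
      exact ⟨(Nat.mem_primesLE.1 this.1).2, this.2⟩
  choose T hT using hT
  filter_upwards [hlim.eventually hev] with n hn
  set s := 1 + 1 / Real.log n
  have hpos : ∀ p ∈ splitPrimesLE K n, 0 < p := fun p hp =>
    (Nat.mem_primesLE.1 (mem_filter.1 hp).1).2.pos
  have h1 : ∏ p ∈ splitPrimesLE K n, (1 + (p : ℝ) ^ (-s)) ^ Module.finrank ℚ K
      = ∏ P ∈ (splitPrimesLE K n).biUnion T, (1 + (absNorm P : ℝ) ^ (-s)) := by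
    rw [prod_biUnion]
    · refine prod_congr rfl fun p hp => ?_
      rw [prod_congr rfl fun P hP => by rw [((hT p n hp).2 P hP).2], prod_const, (hT p n hp).1]
    · intro p hp q hq hpq
      refine disjoint_left.2 fun P hP hQ => hpq ?_
      rw [← ((hT p n hp).2 P hP).2, ((hT q n hq).2 P hQ).2]
  obtain ⟨F, hF, hFs⟩ := prod_one_add_absNorm_eq K ((splitPrimesLE K n).biUnion T) (by
    intro P hP
    obtain ⟨p, hp, hPT⟩ := mem_biUnion.1 hP
    obtain ⟨h2, h3⟩ := (hT p n hp).2 P hPT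
    refine ⟨h2, fun hbot => ?_⟩
    rw [hbot, absNorm_bot] at h3
    exact (hpos p hp).ne h3) s
  rw [h1, hFs]
  refine (sum_absNorm_le_sum_card K F s).trans ((hn _ ?_).trans (le_of_eq ?_))
  · intro h
    obtain ⟨I, hI, h0⟩ := mem_image.1 h
    exact hF I hI (absNorm_eq_zero_iff.1 h0)
  · simp [s]

open Classical in
/-- A lower bound for the sum of the reciprocals of the primes in `nonsplitPrimes K`. -/
theorem le_sum_inv_nonsplitPrimes [Normal ℚ K] :
    ∃ C : ℝ, ∀ᶠ n : ℕ in atTop,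
      (1 - 1 / (Module.finrank ℚ K : ℝ)) * Real.log (Real.log n) - C ≤
        ∑ p ∈ Nat.primesLE n with p ∈ nonsplitPrimes K, 1 / (p : ℝ) := by
  obtain ⟨C, hC, hev⟩ := prod_splitPrimesLE_le K
  refine ⟨(|Real.log C| + 1 + Real.log 4 / Real.log 2 + ∑' k : ℕ, 1 / (k : ℝ) ^ 2) +
    ∑ p ∈ (discr K).natAbs.primeFactors, 1 / (p : ℝ) + 2 * ∑' k : ℕ, 1 / (k : ℝ) ^ 2, ?_⟩
  filter_upwards [hev, eventually_ge_atTop 2] with n hn hn2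
  have h1 := PrimeSums.sum_inv_le_of_prod_le (S := splitPrimesLE K n) hn2 (filter_subset _ _) Module.finrank_pos hC hn
  have h2 := PrimeSums.log_log_le_sum_inv hn2
  have h3 : ∑ p ∈ Nat.primesLE n with p ∉ nonsplitPrimes K, 1 / (p : ℝ) ≤
      ∑ p ∈ splitPrimesLE K n, 1 / (p : ℝ) + ∑ p ∈ (discr K).natAbs.primeFactors, 1 / (p : ℝ) := by
    refine (sum_le_sum_of_subset_of_nonneg ?_ fun p _ _ => by positivity).trans
      (sum_union_inter (s₁ := splitPrimesLE K n) (s₂ := (discr K).natAbs.primeFactors)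
        (f := fun p : ℕ => 1 / (p : ℝ)) ▸ le_add_of_nonneg_right
        (sum_nonneg fun p _ => by positivity))
    intro p hp
    rw [mem_filter] at hp
    rw [mem_union]
    by_cases hd : (p : ℤ) ∣ discr K
    · right
      exact Nat.mem_primeFactors.2 ⟨(Nat.mem_primesLE.1 hp.1).2, Int.natCast_dvd.1 hd,
        Int.natAbs_ne_zero.2 (discr_ne_zero K)⟩
    · exact Or.inl (mem_filter.2 ⟨hp.1, hp.2, hd⟩)
  have h4 := sum_filter_add_sum_filter_not (Nat.primesLE n) (· ∈ nonsplitPrimes K)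
    fun p : ℕ => 1 / (p : ℝ)
  linarith

end BNumbers

namespace SelbergSieve

open Finset

open Classical in
/-- The sets of elements of `Q` with product at most `D`. -/
noncomputable def boundedSubsets (Q : Finset ℕ) (D : ℝ) : Finset (Finset ℕ) :=
  {A ∈ Q.powerset | ∏ p ∈ A, (p : ℝ) ≤ D}

theorem mem_boundedSubsets {Q : Finset ℕ} {D : ℝ} {A : Finset ℕ} :
    A ∈ boundedSubsets Q D ↔ A ⊆ Q ∧ ∏ p ∈ A, (p : ℝ) ≤ D := by
  rw [boundedSubsets, mem_filter, mem_powerset]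

theorem prod_natCast_le_of_subset {A B : Finset ℕ} (hAB : A ⊆ B) (hB : ∀ p ∈ B, p.Prime) :
    ∏ p ∈ A, (p : ℝ) ≤ ∏ p ∈ B, (p : ℝ) :=
  prod_le_prod_of_subset_of_one_le hAB (fun _ _ => Nat.cast_nonneg _)
    fun p hp _ => by exact_mod_cast (hB p hp).one_le

theorem mem_boundedSubsets_of_subset {Q : Finset ℕ} {D : ℝ} (hQ : ∀ p ∈ Q, p.Prime)
    {A B : Finset ℕ} (hA : A ∈ boundedSubsets Q D) (hBA : B ⊆ A) : B ∈ boundedSubsets Q D := by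
  rw [mem_boundedSubsets] at hA ⊢
  exact ⟨hBA.trans hA.1, (prod_natCast_le_of_subset hBA fun p hp => hQ p (hA.1 hp)).trans hA.2⟩

theorem card_boundedSubsets_le {Q : Finset ℕ} {D : ℝ} (hD : 0 ≤ D) (hQ : ∀ p ∈ Q, p.Prime) :
    (#(boundedSubsets Q D) : ℝ) ≤ D := by
  have h1 : #(boundedSubsets Q D) ≤ #(Icc 1 ⌊D⌋₊) := by
    refine card_le_card_of_injOn (fun A => ∏ p ∈ A, p) ?_ ?_
    · intro A hA
      obtain ⟨h1, h2⟩ := mem_boundedSubsets.1 hA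
      rw [mem_coe, mem_Icc]
      refine ⟨prod_pos fun p hp => (hQ p (h1 hp)).pos, Nat.le_floor ?_⟩
      rwa [Nat.cast_prod]
    · intro A hA B hB h
      have hA' := (mem_boundedSubsets.1 hA).1
      have hB' := (mem_boundedSubsets.1 hB).1
      rw [← Nat.primeFactors_prod fun p hp => hQ p (hA' hp),
        ← Nat.primeFactors_prod fun p hp => hQ p (hB' hp)]
      exact congrArg Nat.primeFactors h
  rw [Nat.card_Icc, Nat.add_sub_cancel] at h1
  exact (Nat.cast_le.2 h1).trans (Nat.floor_le hD)

theorem sum_two_pow_card_le {Q : Finset ℕ} {D : ℝ} (hD : 0 ≤ D) (hQ : ∀ p ∈ Q, p.Prime) :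
    ∑ A ∈ boundedSubsets Q D, (2 : ℝ) ^ #A ≤ D ^ 2 := by
  calc _ ≤ ∑ A ∈ boundedSubsets Q D, D := by
        refine sum_le_sum fun A hA => ?_
        obtain ⟨h1, h2⟩ := mem_boundedSubsets.1 hA
        refine le_trans ?_ h2
        rw [← prod_const]
        exact prod_le_prod (fun _ _ => zero_le_two) fun p hp => by
          exact_mod_cast (hQ p (h1 hp)).two_le
    _ ≤ D ^ 2 := by
        rw [sum_const, nsmul_eq_mul, sq]
        exact mul_le_mul_of_nonneg_right (card_boundedSubsets_le hD hQ) hD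

theorem one_add_dual {ι : Type*} {g : ι → ℝ} {i : ι} (h : g i ≤ 1 / 2) :
    1 + dual g i = (1 - g i)⁻¹ := by
  have : 1 - g i ≠ 0 := by linarith
  rw [dual]
  field_simp
  ring

/-- Summing the multiplicative weights of the subsets of `Q` through a fixed element. -/
theorem sum_powerset_prod_dual_mem {g : ℕ → ℝ} {Q : Finset ℕ} (hg : ∀ p ∈ Q, 0 < g p ∧ g p ≤ 1 / 2)
    {p : ℕ} (hp : p ∈ Q) :
    ∑ A ∈ Q.powerset with p ∈ A, ∏ q ∈ A, dual g q = (∏ q ∈ Q, (1 + dual g q)) * g p := by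
  have h1 := sum_filter_add_sum_filter_not Q.powerset (p ∈ ·) fun A => ∏ q ∈ A, dual g q
  have h2 : {A ∈ Q.powerset | p ∉ A} = (Q.erase p).powerset := by
    ext A
    rw [mem_filter, mem_powerset, mem_powerset, subset_erase]
  rw [h2, ← prod_one_add, ← prod_one_add, ← mul_prod_erase Q _ hp] at h1
  rw [← mul_prod_erase Q _ hp]
  have h3 : (1 + dual g p) * (1 - g p) = 1 := by
    rw [one_add_dual (hg p hp).2]
    exact inv_mul_cancel₀ (by linarith [(hg p hp).2])
  linear_combination h1 + (∏ q ∈ Q.erase p, (1 + dual g q)) * h3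

/-- A lower bound for the truncated mass by the full Euler product. -/
theorem half_prod_le_mass {g : ℕ → ℝ} {Q : Finset ℕ} {D : ℝ} (hQ : ∀ p ∈ Q, p.Prime)
    (hg : ∀ p ∈ Q, 0 < g p ∧ g p ≤ 1 / 2) (hD : 1 < D)
    (h : ∑ p ∈ Q, g p * Real.log p ≤ Real.log D / 2) :
    (∏ p ∈ Q, (1 + dual g p)) / 2 ≤ mass g (boundedSubsets Q D) := by
  classical
  have hlD : 0 < Real.log D := Real.log_pos hD
  have hdual : ∀ p ∈ Q, 0 < dual g p := fun p hp =>
    div_pos (hg p hp).1 (by linarith [(hg p hp).2])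
  set V := ∏ p ∈ Q, (1 + dual g p) with hV
  have hVpos : 0 < V := prod_pos fun p hp => by linarith [hdual p hp]
  have hA0 : ∀ A ∈ Q.powerset, 0 < ∏ p ∈ A, dual g p := fun A hA =>
    prod_pos fun p hp => hdual p (mem_powerset.1 hA hp)
  have h1 : ∑ A ∈ Q.powerset, (∏ p ∈ A, dual g p) * (1 - (∑ p ∈ A, Real.log p) / Real.log D)
      ≤ mass g (boundedSubsets Q D) := by
    rw [mass, boundedSubsets, sum_filter]
    refine sum_le_sum fun A hA => ?_
    have hAp : ∀ p ∈ A, (0 : ℝ) < p := fun p hp => by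
      exact_mod_cast (hQ p (mem_powerset.1 hA hp)).pos
    have hlog : ∑ p ∈ A, Real.log p = Real.log (∏ p ∈ A, (p : ℝ)) :=
      (Real.log_prod fun p hp => (hAp p hp).ne').symm
    split_ifs with hle
    · refine mul_le_of_le_one_right (hA0 A hA).le (sub_le_self _ (div_nonneg ?_ hlD.le))
      exact sum_nonneg fun p _ => Real.log_natCast_nonneg p
    · refine mul_nonpos_of_nonneg_of_nonpos (hA0 A hA).le (sub_nonpos.2 ?_)
      rw [one_le_div hlD, hlog]
      exact Real.log_le_log (by linarith) (not_le.1 hle).le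
  have h2 : ∑ A ∈ Q.powerset, (∏ p ∈ A, dual g p) * ∑ p ∈ A, Real.log p
      = V * ∑ p ∈ Q, g p * Real.log p := by
    calc _ = ∑ A ∈ Q.powerset, ∑ p ∈ Q, if p ∈ A then
          (∏ q ∈ A, dual g q) * Real.log p else 0 := by
          refine sum_congr rfl fun A hA => ?_
          rw [mul_sum, ← sum_filter, filter_mem_eq_inter, inter_eq_right.2 (mem_powerset.1 hA)]
      _ = ∑ p ∈ Q, (∑ A ∈ Q.powerset with p ∈ A, ∏ q ∈ A, dual g q) * Real.log p := by
          rw [sum_comm]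
          refine sum_congr rfl fun p _ => ?_
          rw [← sum_filter, sum_mul]
      _ = _ := by
          rw [mul_sum]
          refine sum_congr rfl fun p hp => ?_
          rw [sum_powerset_prod_dual_mem hg hp, mul_assoc]
  have h3 : ∑ A ∈ Q.powerset, (∏ p ∈ A, dual g p) * (1 - (∑ p ∈ A, Real.log p) / Real.log D)
      = V - V * (∑ p ∈ Q, g p * Real.log p) / Real.log D := by
    simp_rw [mul_sub, mul_one, ← mul_div_assoc]
    rw [sum_sub_distrib, ← sum_div, h2, ← prod_one_add]
  have h4 : V * (∑ p ∈ Q, g p * Real.log p) / Real.log D ≤ V / 2 := by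
    rw [div_le_iff₀ hlD]
    nlinarith
  linarith

/-- Removing a set of primes costs at most its Euler product. -/
theorem mass_le_mass_sdiff_mul {g : ℕ → ℝ} {Q E : Finset ℕ} {D : ℝ} (hQ : ∀ p ∈ Q, p.Prime)
    (hg : ∀ p ∈ Q, 0 < g p ∧ g p ≤ 1 / 2) :
    mass g (boundedSubsets Q D) ≤
      mass g (boundedSubsets (Q \ E) D) * ∏ p ∈ Q ∩ E, (1 + dual g p) := by
  have hdual : ∀ p ∈ Q, 0 < dual g p := fun p hp =>
    div_pos (hg p hp).1 (by linarith [(hg p hp).2])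
  rw [prod_one_add, mass, mass, sum_mul_sum, ← sum_product']
  have h1 : ∑ A ∈ boundedSubsets Q D, ∏ p ∈ A, dual g p
      = ∑ x ∈ (boundedSubsets Q D).image (fun A => (A \ E, A ∩ E)),
        (∏ p ∈ x.1, dual g p) * ∏ p ∈ x.2, dual g p := by
    rw [sum_image]
    · refine sum_congr rfl fun A _ => ?_
      rw [mul_comm, prod_inter_mul_prod_sdiff]
    · intro A _ B _ h
      simp only [Prod.mk.injEq] at h
      rw [← sdiff_union_inter A E, ← sdiff_union_inter B E, h.1, h.2]
  rw [h1]
  refine sum_le_sum_of_subset_of_nonneg ?_ ?_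
  · intro x hx
    obtain ⟨A, hA, rfl⟩ := mem_image.1 hx
    have hA' := mem_boundedSubsets.1 hA
    rw [mem_product, mem_powerset, mem_boundedSubsets]
    exact ⟨⟨sdiff_subset_sdiff hA'.1 le_rfl, (prod_natCast_le_of_subset sdiff_subset
      fun p hp => hQ p (hA'.1 hp)).trans hA'.2⟩, inter_subset_inter hA'.1 le_rfl⟩
  · rintro ⟨A, B⟩ hx _
    rw [mem_product, mem_powerset, mem_boundedSubsets] at hx
    exact mul_nonneg (prod_nonneg fun p hp => (hdual p (sdiff_subset (hx.1.1 hp))).le)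
      (prod_nonneg fun p hp => (hdual p (inter_subset_left (hx.2 hp))).le)

end SelbergSieve

namespace BNumbers

open Finset SelbergSieve

theorem exactDensity_le {M p : ℕ} (hp : 0 < p) : exactDensity M p ≤ M / p := by
  have hp0 : (0 : ℝ) < p := by exact_mod_cast hp
  have h0 : (0 : ℝ) ≤ M := Nat.cast_nonneg M
  rw [exactDensity, div_le_div_iff₀ (by positivity) hp0]
  nlinarith [mul_nonneg h0 hp0.le]

theorem le_exactDensity {M p : ℕ} (hp : 0 < p) :
    M * (1 / (p : ℝ)) - M * (1 / (p : ℝ) ^ 2) ≤ exactDensity M p := by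
  have hp0 : (0 : ℝ) < p := by exact_mod_cast hp
  rw [exactDensity]
  refine le_of_eq ?_
  field_simp

theorem div_le_half {M p : ℕ} (hMp : 2 * M < p) : (M : ℝ) / p ≤ 1 / 2 := by
  have : (2 : ℝ) * M < p := by exact_mod_cast hMp
  have h0 : (0 : ℝ) ≤ M := Nat.cast_nonneg M
  rw [div_le_div_iff₀ (by linarith) two_pos]
  linarith

theorem exactDensity_bounds {M p : ℕ} (hM : 0 < M) (hp : p.Prime) (hMp : 2 * M < p) :
    0 < exactDensity M p ∧ exactDensity M p ≤ 1 / 2 := by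
  have hp1 : (1 : ℝ) < p := by exact_mod_cast hp.one_lt
  have hM' : (0 : ℝ) < M := by exact_mod_cast hM
  exact ⟨div_pos (mul_pos hM' (by linarith)) (by positivity),
    (exactDensity_le hp.pos).trans (div_le_half hMp)⟩

theorem one_add_dual_exactDensity_le {M p : ℕ} (hp : 0 < p) (hMp : 2 * M < p) :
    1 + dual (exactDensity M) p ≤
      (1 + (M : ℝ) / p) * Real.exp (2 * M ^ 2 * (1 / (p : ℝ) ^ 2)) := by
  have h1 := exactDensity_le (M := M) hp
  have h2 := div_le_half hMp
  have h3 : (0 : ℝ) ≤ M / p := by positivity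
  rw [one_add_dual (h1.trans h2)]
  set u := (M : ℝ) / p with hu
  have e : 2 * (M : ℝ) ^ 2 * (1 / (p : ℝ) ^ 2) = 2 * u ^ 2 := by rw [hu, div_pow]; ring
  rw [e]
  calc (1 - exactDensity M p)⁻¹ ≤ (1 - u)⁻¹ := inv_anti₀ (by linarith) (by linarith)
    _ ≤ (1 + u) * (2 * u ^ 2 + 1) := by
        rw [inv_le_iff_one_le_mul₀ (by linarith)]
        have h4 : u ^ 2 ≤ 1 / 4 := by nlinarith
        nlinarith [mul_nonneg (sq_nonneg u) (by linarith : 0 ≤ 1 - 2 * u ^ 2)]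
    _ ≤ _ := mul_le_mul_of_nonneg_left (Real.add_one_le_exp _) (by linarith)

variable (K : Type*) [Field K] [NumberField K]

theorem one_le_gammaFactor {M : ℕ} (a b : Fin M → ℤ) : 1 ≤ gammaFactor K a b := by
  rw [gammaFactor]
  exact Finset.one_le_prod fun p _ =>
    le_add_of_nonneg_right (div_nonneg (Nat.cast_nonneg M) (Nat.cast_nonneg p))

theorem prod_one_add_dual_le_gammaFactor {M : ℕ} (a b : Fin M → ℤ) {Q : Finset ℕ}
    (hQ : ∀ p ∈ Q, p.Prime ∧ 2 * M < p) :
    ∏ p ∈ Q ∩ exceptionalPrimes K a b, (1 + dual (exactDensity M) p) ≤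
      Real.exp (2 * M ^ 2 * ∑' k : ℕ, 1 / (k : ℝ) ^ 2) * gammaFactor K a b := by
  set E := exceptionalPrimes K a b
  have hmem : ∀ p ∈ Q ∩ E, p.Prime ∧ 2 * M < p := fun p hp => hQ p (mem_inter.1 hp).1
  calc _ ≤ ∏ p ∈ Q ∩ E, (1 + (M : ℝ) / p) * Real.exp (2 * M ^ 2 * (1 / (p : ℝ) ^ 2)) := by
        refine prod_le_prod (fun p hp => ?_) fun p hp =>
          one_add_dual_exactDensity_le (hmem p hp).1.pos (hmem p hp).2
        have h1 := (exactDensity_le (M := M) (hmem p hp).1.pos).trans (div_le_half (hmem p hp).2)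
        rw [one_add_dual h1]
        exact inv_nonneg.2 (by linarith)
    _ = Real.exp (2 * M ^ 2 * ∑ p ∈ Q ∩ E, 1 / (p : ℝ) ^ 2) * ∏ p ∈ Q ∩ E, (1 + (M : ℝ) / p) := by
        rw [prod_mul_distrib, ← Real.exp_sum, ← mul_sum, mul_comm]
    _ ≤ _ := by
        refine mul_le_mul (Real.exp_le_exp.2 (mul_le_mul_of_nonneg_left
          (PrimeSums.sum_inv_sq_le _) (by positivity))) ?_ (by positivity) (Real.exp_pos _).le
        exact prod_le_prod_of_subset_of_one_le inter_subset_right (fun p _ => by positivity)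
          fun p _ _ => le_add_of_nonneg_right (by positivity)

theorem not_dvd_of_notMem_exceptionalPrimes {M : ℕ} {a b : Fin M → ℤ} (ha : ∀ m, 0 < a m)
    (hab : crossProduct a b ≠ 0) {p : ℕ} (hp : p ∈ nonsplitPrimes K)
    (hpE : p ∉ exceptionalPrimes K a b) :
    (∀ m, ¬ (p : ℤ) ∣ a m) ∧ ∀ m k, m ≠ k → ¬ (p : ℤ) ∣ a m * b k - a k * b m := by
  have h0 : (∏ m, a m) * crossProduct a b ≠ 0 :=
    mul_ne_zero (prod_ne_zero_iff.2 fun m _ => (ha m).ne') hab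
  rw [mem_exceptionalPrimes K a b h0] at hpE
  have hdvd : ¬ (p : ℤ) ∣ (∏ m, a m) * crossProduct a b := fun h => hpE ⟨hp, h⟩
  refine ⟨fun m h => hdvd ?_, fun m k hmk h => hdvd ?_⟩
  · exact (h.trans (dvd_prod_of_mem a (mem_univ m))).mul_right _
  · refine Dvd.dvd.mul_left (h.trans ?_) _
    refine dvd_trans ?_ (dvd_prod_of_mem _ (mem_univ m))
    exact dvd_prod_of_mem (fun k => a m * b k - a k * b m)
      (mem_filter.2 ⟨mem_univ k, hmk.symm⟩)

open Classical in
theorem tupleSum_le_card {M : ℕ} (a b : Fin M → ℤ) (x : ℝ) {Q : Finset ℕ}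
    (hQ : ∀ p ∈ Q, p ∈ nonsplitPrimes K) {𝒟 : Finset (Finset ℕ)} (h𝒟 : ∀ A ∈ 𝒟, A ⊆ Q) :
    tupleSum K a b x ≤
      #{n ∈ Icc 1 ⌊x⌋₊ | ∀ A ∈ 𝒟, ∀ p ∈ A, ¬ ExactlyDividesSome a b p n} := by
  rw [tupleSum, card_eq_sum_ones, sum_filter]
  refine sum_le_sum fun n _ => ?_
  split_ifs with h
  · exact prod_le_one' fun m _ => idealNormIndicator_le_one K _
  · push Not at h
    obtain ⟨A, hA, p, hp, m, h1, h2⟩ := h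
    exact (prod_eq_zero (mem_univ m)
      (idealNormIndicator_eq_zero K (hQ p (h𝒟 A hA hp)) h1 h2)).le

open Classical in
/-- The primes of `nonsplitPrimes K` in the interval `(2 * M, y]`. -/
noncomputable def siftingPrimes (M y : ℕ) : Finset ℕ :=
  {p ∈ Nat.primesLE y | p ∈ nonsplitPrimes K ∧ 2 * M < p}

theorem mem_siftingPrimes {M y p : ℕ} :
    p ∈ siftingPrimes K M y ↔ (p ≤ y ∧ p.Prime) ∧ p ∈ nonsplitPrimes K ∧ 2 * M < p := by
  classical
  simp only [siftingPrimes, mem_filter, Nat.mem_primesLE]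

theorem exp_le_mass {M y : ℕ} (hM : 0 < M) (hy : 1 ≤ y) {D : ℝ} (hD : 1 < D)
    (h : M * (Real.log y + Real.log 4) ≤ Real.log D / 2) :
    Real.exp (M * ∑ p ∈ siftingPrimes K M y, 1 / (p : ℝ) - M * ∑' k : ℕ, 1 / (k : ℝ) ^ 2) / 2 ≤
      mass (exactDensity M) (boundedSubsets (siftingPrimes K M y) D) := by
  have hQ : ∀ p ∈ siftingPrimes K M y, p.Prime := fun p hp => ((mem_siftingPrimes K).1 hp).1.2
  have hg : ∀ p ∈ siftingPrimes K M y, 0 < exactDensity M p ∧ exactDensity M p ≤ 1 / 2 :=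
    fun p hp => exactDensity_bounds hM (hQ p hp) ((mem_siftingPrimes K).1 hp).2.2
  have hsum : ∑ p ∈ siftingPrimes K M y, exactDensity M p * Real.log p ≤ Real.log D / 2 := by
    refine le_trans ?_ h
    calc _ ≤ ∑ p ∈ siftingPrimes K M y, M * (Real.log p / p) := by
          refine sum_le_sum fun p hp => ?_
          rw [mul_div_left_comm, mul_comm]
          exact mul_le_mul_of_nonneg_left (exactDensity_le (hQ p hp).pos)
            (Real.log_natCast_nonneg p)
      _ ≤ M * ∑ p ∈ Nat.primesLE y, Real.log p / p := by
          rw [← mul_sum]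
          refine mul_le_mul_of_nonneg_left (sum_le_sum_of_subset_of_nonneg
            (fun p hp => Nat.mem_primesLE.2 ((mem_siftingPrimes K).1 hp).1) fun p _ _ => ?_) (Nat.cast_nonneg M)
          exact div_nonneg (Real.log_natCast_nonneg p) (Nat.cast_nonneg p)
      _ ≤ _ := mul_le_mul_of_nonneg_left (PrimeSums.sum_log_div_le hy) (Nat.cast_nonneg M)
  refine le_trans ?_ (half_prod_le_mass hQ hg hD hsum)
  refine div_le_div_of_nonneg_right ?_ two_pos.le
  calc _ ≤ Real.exp (∑ p ∈ siftingPrimes K M y, exactDensity M p) := by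
        refine Real.exp_le_exp.2 ?_
        have h1 := sum_le_sum fun p hp => le_exactDensity (M := M) (hQ p hp).pos
        rw [sum_sub_distrib, ← mul_sum, ← mul_sum] at h1
        have h2 := mul_le_mul_of_nonneg_left (PrimeSums.sum_inv_sq_le (siftingPrimes K M y))
          (Nat.cast_nonneg (α := ℝ) M)
        linarith
    _ ≤ _ := by
        rw [Real.exp_sum]
        refine prod_le_prod (fun p _ => (Real.exp_pos _).le) fun p hp => ?_
        have h1 := hg p hp
        rw [one_add_dual h1.2, le_inv_comm₀ (Real.exp_pos _) (by linarith), ← Real.exp_neg]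
        linarith [Real.add_one_le_exp (-exactDensity M p)]

/-- The sieve bound with free parameters: `y` bounds the sifting primes and `D` is the level. -/
theorem tupleSum_le_of_level {M y : ℕ} (hM : 0 < M) (hy : 1 ≤ y) {D : ℝ} (hD : 1 < D)
    (h : M * (Real.log y + Real.log 4) ≤ Real.log D / 2) {a b : Fin M → ℤ} (ha : ∀ m, 0 < a m)
    (hab : crossProduct a b ≠ 0) {x : ℝ} (hx : 0 ≤ x) :
    (tupleSum K a b x : ℝ) ≤
      2 * Real.exp ((2 * M ^ 2 + M) * ∑' k : ℕ, 1 / (k : ℝ) ^ 2) * gammaFactor K a b * x *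
        Real.exp (-(M * ∑ p ∈ siftingPrimes K M y, 1 / (p : ℝ))) + D ^ 8 := by
  classical
  set E := exceptionalPrimes K a b
  set Q := siftingPrimes K M y with hQdef
  set Z := ∑' k : ℕ, 1 / (k : ℝ) ^ 2
  set γ := gammaFactor K a b
  have hQ : ∀ p ∈ Q, p.Prime := fun p hp => ((mem_siftingPrimes K).1 hp).1.2
  have hQn : ∀ p ∈ Q, p ∈ nonsplitPrimes K := fun p hp => ((mem_siftingPrimes K).1 hp).2.1
  have hQM : ∀ p ∈ Q, 2 * M < p := fun p hp => ((mem_siftingPrimes K).1 hp).2.2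
  have hg : ∀ p ∈ Q, 0 < exactDensity M p ∧ exactDensity M p ≤ 1 / 2 :=
    fun p hp => exactDensity_bounds hM (hQ p hp) (hQM p hp)
  set 𝒟 := boundedSubsets (Q \ E) D with h𝒟
  have hsub : ∀ A ∈ 𝒟, A ⊆ Q \ E := fun A hA => (mem_boundedSubsets.1 hA).1
  have hQE : ∀ p ∈ Q \ E, p.Prime := fun p hp => hQ p (mem_sdiff.1 hp).1
  have h0 : ∅ ∈ 𝒟 := mem_boundedSubsets.2 ⟨empty_subset _, by simpa using hD.le⟩
  have hgD : ∀ A ∈ 𝒟, ∀ p ∈ A, 0 < exactDensity M p ∧ exactDensity M p ≤ 1 / 2 :=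
    fun A hA p hp => hg p (mem_sdiff.1 (hsub A hA hp)).1
  have hcard := card_sifted_le hgD (Icc 1 ⌊x⌋₊) (ExactlyDividesSome a b) h0
    (fun A hA B hB => mem_boundedSubsets_of_subset hQE hA hB) (⌊x⌋₊ : ℝ) (D ^ 4) (by
      intro A hA B hB
      have hAB : ∀ p ∈ A ∪ B, p ∈ Q \ E := fun p hp =>
        (mem_union.1 hp).elim (fun h => hsub A hA h) fun h => hsub B hB h
      refine (abs_card_exactlyDividesSome_sub_le a b (A ∪ B) (fun p hp => ⟨hQE p (hAB p hp),
        not_dvd_of_notMem_exceptionalPrimes K ha hab (hQn p (mem_sdiff.1 (hAB p hp)).1)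
          (mem_sdiff.1 (hAB p hp)).2⟩) ⌊x⌋₊).trans ?_
      have h1 : ∏ p ∈ A ∪ B, (p : ℝ) ≤ D * D := by
        have hone : 1 ≤ ∏ p ∈ A ∩ B, (p : ℝ) := Finset.one_le_prod fun p hp => by
          exact_mod_cast (hQE p (hsub A hA (mem_inter.1 hp).1)).one_le
        calc _ ≤ (∏ p ∈ A ∪ B, (p : ℝ)) * ∏ p ∈ A ∩ B, (p : ℝ) :=
              le_mul_of_one_le_right (prod_nonneg fun _ _ => Nat.cast_nonneg _) hone
          _ = (∏ p ∈ A, (p : ℝ)) * ∏ p ∈ B, (p : ℝ) := prod_union_inter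
          _ ≤ D * D := mul_le_mul (mem_boundedSubsets.1 hA).2 (mem_boundedSubsets.1 hB).2
              (prod_nonneg fun _ _ => Nat.cast_nonneg _) (by linarith)
      calc _ ≤ (D * D) ^ 2 := pow_le_pow_left₀ (prod_nonneg fun _ _ => Nat.cast_nonneg _) h1 2
        _ = D ^ 4 := by ring)
  have hmain : (tupleSum K a b x : ℝ) ≤ x / mass (exactDensity M) 𝒟 + D ^ 8 := by
    have hm := mass_pos hgD h0
    refine (Nat.cast_le.2 (tupleSum_le_card K a b x (fun p hp => hQn p (mem_sdiff.1 hp).1)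
      hsub)).trans (hcard.trans (add_le_add ?_ ?_))
    · exact div_le_div_of_nonneg_right (Nat.floor_le hx) hm.le
    · have h1 := sum_two_pow_card_le (by linarith : 0 ≤ D) hQE
      calc _ ≤ D ^ 4 * (D ^ 2) ^ 2 := mul_le_mul_of_nonneg_left
            (pow_le_pow_left₀ (sum_nonneg fun _ _ => by positivity) h1 2) (by positivity)
        _ = D ^ 8 := by ring
  have hmass : Real.exp (M * ∑ p ∈ Q, 1 / (p : ℝ) - M * Z) / 2 ≤
      mass (exactDensity M) 𝒟 * (Real.exp (2 * M ^ 2 * Z) * γ) :=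
    (exp_le_mass K hM hy hD h).trans ((mass_le_mass_sdiff_mul (E := E) hQ hg).trans
      (mul_le_mul_of_nonneg_left
        (prod_one_add_dual_le_gammaFactor K a b fun p hp => ⟨hQ p hp, hQM p hp⟩)
        (mass_pos hgD h0).le))
  refine hmain.trans (add_le_add_left ?_ _)
  have hm := mass_pos hgD h0
  have hγ : 0 < γ := zero_lt_one.trans_le (one_le_gammaFactor K a b)
  rw [div_le_iff₀ hm]
  set m := mass (exactDensity M) 𝒟
  set T := (M : ℝ) * ∑ p ∈ Q, 1 / (p : ℝ)
  have e1 : Real.exp ((2 * M ^ 2 + M) * Z) = Real.exp (2 * M ^ 2 * Z) * Real.exp (M * Z) := by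
    rw [← Real.exp_add]
    ring_nf
  have e2 : Real.exp (M * Z) * Real.exp (-T) * Real.exp (T - M * Z) = 1 := by
    rw [← Real.exp_add, ← Real.exp_add, ← Real.exp_zero]
    ring_nf
  have h1 := mul_le_mul_of_nonneg_left hmass
    (by positivity : 0 ≤ 2 * x * (Real.exp (M * Z) * Real.exp (-T)))
  calc x = 2 * x * (Real.exp (M * Z) * Real.exp (-T)) * (Real.exp (T - M * Z) / 2) := by
        linear_combination (-x) * e2
    _ ≤ _ := h1
    _ = _ := by rw [e1]; ring

end BNumbers

namespace BNumbers

open Finset Filter SelbergSieve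

variable (K : Type*) [Field K] [NumberField K]

theorem exists_exp_neg_sum_siftingPrimes_le [Normal ℚ K] (M : ℕ) :
    ∃ C : ℝ, 0 < C ∧ ∀ᶠ y : ℕ in atTop,
      Real.exp (-(M * ∑ p ∈ siftingPrimes K M y, 1 / (p : ℝ))) ≤
        C * Real.log y ^ (-(M * (1 - 1 / (Module.finrank ℚ K : ℝ)))) := by
  classical
  obtain ⟨C, hC⟩ := le_sum_inv_nonsplitPrimes K
  refine ⟨Real.exp (M * (C + ∑ p ∈ range (2 * M + 1), 1 / (p : ℝ))), Real.exp_pos _, ?_⟩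
  filter_upwards [hC, eventually_ge_atTop 2] with y hy hy2
  have hlog : 0 < Real.log y := Real.log_pos (by exact_mod_cast hy2)
  have h1 : ∑ p ∈ Nat.primesLE y with p ∈ nonsplitPrimes K, 1 / (p : ℝ) ≤
      ∑ p ∈ siftingPrimes K M y, 1 / (p : ℝ) + ∑ p ∈ range (2 * M + 1), 1 / (p : ℝ) := by
    rw [← sum_union_inter]
    refine (sum_le_sum_of_subset_of_nonneg ?_ fun p _ _ => by positivity).trans
      (le_add_of_nonneg_right (sum_nonneg fun p _ => by positivity))
    intro p hp
    obtain ⟨h1, h2⟩ := mem_filter.1 hp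
    rw [mem_union, mem_siftingPrimes, mem_range]
    by_cases h : 2 * M < p
    · exact Or.inl ⟨Nat.mem_primesLE.1 h1, h2, h⟩
    · exact Or.inr (by omega)
  rw [Real.rpow_def_of_pos hlog, ← Real.exp_add]
  refine Real.exp_le_exp.2 ?_
  have h2 := mul_le_mul_of_nonneg_left (hy.trans h1) (Nat.cast_nonneg (α := ℝ) M)
  linarith

end BNumbers

theorem mainTheorem1 (K : Type*) [Field K] [NumberField K] [Normal ℚ K]
    (hN : 2 ≤ Module.finrank ℚ K) (M : ℕ) (hM : 2 ≤ M) :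
    ∃ C x₀ : ℝ, 0 < C ∧ ∀ a b : Fin M → ℤ, (∀ m, 0 < a m) →
      BNumbers.crossProduct a b ≠ 0 →
      ∀ x : ℝ, x₀ ≤ x →
        (BNumbers.tupleSum K a b x : ℝ) ≤
          C * BNumbers.gammaFactor K a b *
            (x / (Real.log x) ^ ((M : ℝ) * (1 - 1 / (Module.finrank ℚ K : ℝ)))) := by
  obtain ⟨C, hC, hev⟩ := BNumbers.exists_exp_neg_sum_siftingPrimes_le K M
  have hM0 : (0 : ℝ) < M := by exact_mod_cast (by omega : 0 < M)
  have hN0 : (1 : ℝ) ≤ Module.finrank ℚ K := by exact_mod_cast (by omega : 1 ≤ Module.finrank ℚ K)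
  set κ : ℝ := M * (1 - 1 / (Module.finrank ℚ K : ℝ)) with hκdef
  have hκ : 0 ≤ κ := mul_nonneg hM0.le (sub_nonneg.2 ((div_le_one (by linarith)).2 hN0))
  set θ : ℝ := 1 / (64 * M) with hθdef
  have hθ : 0 < θ := by positivity
  set B : ℝ := 2 * Real.exp ((2 * M ^ 2 + M) * ∑' k : ℕ, 1 / (k : ℝ) ^ 2)
  have hB : 0 < B := by positivity
  have hpow : Filter.Tendsto (fun x : ℝ => x ^ θ) Filter.atTop Filter.atTop := tendsto_rpow_atTop hθ
  have hfloor : Filter.Tendsto (fun x : ℝ => ⌊x ^ θ⌋₊) Filter.atTop Filter.atTop :=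
    tendsto_nat_floor_atTop.comp hpow
  have hsmall : ∀ᶠ x : ℝ in Filter.atTop, Real.log x ^ κ ≤ x ^ (1 / 2 : ℝ) := by
    filter_upwards [(isLittleO_log_rpow_rpow_atTop κ (half_pos one_pos)).bound one_pos,
      Filter.eventually_gt_atTop 1] with x hx hx1
    rw [one_mul, Real.norm_of_nonneg (Real.rpow_nonneg (Real.log_nonneg hx1.le) _),
      Real.norm_of_nonneg (Real.rpow_nonneg (by linarith) _)] at hx
    exact hx
  have hall : ∀ᶠ x : ℝ in Filter.atTop, ∀ a b : Fin M → ℤ, (∀ m, 0 < a m) →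
      BNumbers.crossProduct a b ≠ 0 → (BNumbers.tupleSum K a b x : ℝ) ≤
        (B * C * (128 * M) ^ κ + 1) * BNumbers.gammaFactor K a b * (x / Real.log x ^ κ) := by
    filter_upwards [hfloor.eventually hev, hsmall, hpow.eventually_ge_atTop 4,
      Filter.eventually_gt_atTop 1,
      Real.tendsto_log_atTop.eventually_ge_atTop (64 * M * Real.log 4)] with
      x hy hx2 hx4 hx1 hxl a b ha hab
    have hx0 : 0 < x := by linarith
    have hl : 0 < Real.log x := Real.log_pos hx1
    set y := ⌊x ^ θ⌋₊
    have hy4 : 4 ≤ y := Nat.le_floor (by exact_mod_cast hx4)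
    have hy0 : (0 : ℝ) < y := by exact_mod_cast (by omega : 0 < y)
    have hyle : Real.log y ≤ θ * Real.log x := by
      rw [← Real.log_rpow hx0]
      exact Real.log_le_log hy0 (Nat.floor_le (by linarith))
    have hyge : 1 / (128 * M) * Real.log x ≤ Real.log y := by
      have h1 : x ^ θ ≤ (y : ℝ) ^ 2 := by
        have h2 := Nat.lt_floor_add_one (x ^ θ)
        have h3 : (4 : ℝ) ≤ y := by exact_mod_cast hy4
        nlinarith
      have h2 := Real.log_le_log (by linarith) h1
      rw [Real.log_rpow hx0, Real.log_pow, hθdef] at h2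
      have h3 : 1 / (64 * (M : ℝ)) * Real.log x = 2 * (1 / (128 * M) * Real.log x) := by
        field_simp
        norm_num
      rw [h3] at h2
      push_cast at h2
      linarith
    have hD : (1 : ℝ) < x ^ (1 / 16 : ℝ) := Real.one_lt_rpow hx1 (by norm_num)
    have hlevel : M * (Real.log y + Real.log 4) ≤ Real.log (x ^ (1 / 16 : ℝ)) / 2 := by
      rw [Real.log_rpow hx0]
      have h1 := mul_le_mul_of_nonneg_left hyle hM0.le
      have h2 : M * (θ * Real.log x) = 1 / 64 * Real.log x := by
        rw [hθdef]
        field_simp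
      linarith
    have hsieve := BNumbers.tupleSum_le_of_level K (by omega) (by omega : 1 ≤ y) hD hlevel ha hab
      hx0.le
    have hD8 : (x ^ (1 / 16 : ℝ)) ^ 8 = x ^ (1 / 2 : ℝ) := by
      rw [← Real.rpow_natCast, ← Real.rpow_mul hx0.le]
      norm_num
    rw [hD8] at hsieve
    have hγ := BNumbers.one_le_gammaFactor K a b
    set γ := BNumbers.gammaFactor K a b
    have hlκ : 0 < Real.log x ^ κ := Real.rpow_pos_of_pos hl _
    have hmain : Real.log y ^ (-κ) ≤ (128 * M) ^ κ * (Real.log x ^ κ)⁻¹ := by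
      calc _ ≤ (1 / (128 * M) * Real.log x) ^ (-κ) :=
            Real.rpow_le_rpow_of_nonpos (by positivity) hyge (neg_nonpos.2 hκ)
        _ = _ := by
            rw [Real.mul_rpow (by positivity) hl.le, one_div, Real.inv_rpow (by positivity),
              Real.rpow_neg (by positivity), Real.rpow_neg hl.le, inv_inv]
    have hrem : x ^ (1 / 2 : ℝ) ≤ γ * (x / Real.log x ^ κ) := by
      have h1 : x ^ (1 / 2 : ℝ) ≤ x / Real.log x ^ κ := by
        rw [le_div_iff₀ hlκ]
        calc _ ≤ x ^ (1 / 2 : ℝ) * x ^ (1 / 2 : ℝ) :=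
              mul_le_mul_of_nonneg_left hx2 (Real.rpow_nonneg hx0.le _)
          _ = x := by rw [← Real.rpow_add hx0]; norm_num
      exact h1.trans (le_mul_of_one_le_left (by positivity) hγ)
    have hBγ : 0 ≤ B * γ * x := by positivity
    have hexp := mul_le_mul_of_nonneg_left (hy.trans (mul_le_mul_of_nonneg_left hmain hC.le)) hBγ
    calc _ ≤ _ := hsieve
      _ ≤ B * γ * x * (C * ((128 * M) ^ κ * (Real.log x ^ κ)⁻¹)) + γ * (x / Real.log x ^ κ) :=
          add_le_add hexp hrem
      _ = _ := by rw [div_eq_mul_inv]; ring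
  obtain ⟨x₀, hx₀⟩ := Filter.eventually_atTop.1 hall
  exact ⟨B * C * (128 * M) ^ κ + 1, x₀, by positivity, fun a b ha hab x hx => hx₀ x hx a b ha hab⟩
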